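/- **Setting.** Let $0<p,q<1$ be real and generic ($p^aq^b=1$ with $a,b\in\mathbb Z$ only for $a=b=0$), and let $\theta(z)=\prod_{j\ge 0}(1-zp^j)(1-p^{j+1}/z)$ for $z \in \mathbb C^\times$. Let $\mathfrak h$ be the space of traceless diagonal complex $n\times n$ matrices, $\omega(i)\in\mathfrak h^*$ the $i$-th diagonal entry, $\zeta_{ij}=\zeta(E_{ii}-E_{jj})$ for $\zeta\in\mathfrak h^*$, $M_{\mathfrak h^*}$ the algebra of meromorphic functions on $\mathfrak h^*$, $(T_\mu f)(\zeta)=f(\zeta+\mu)$, and $V=\mathbb C^n$ with basis $e_1,\dots,e_n$ of weights $\omega(1),\dots,\omega(n)$. Put $$\alpha(s,z)=\frac{\theta(z)\,\theta(q^{2(s+1)})}{\theta(q^2z)\,\theta(q^{2s})},\qquad \beta(s,z)=\frac{\theta(q^2)\,\theta(q^{-2s}z)}{\theta(q^2z)\,\theta(q^{-2s})},$$ $$R(\zeta,z)=\sum_i E_{ii}\otimes E_{ii}+\sum_{i\ne j}\alpha(\zeta_{ij},z)E_{ii}\otimes E_{jj}+\sum_{i\neq j}\beta(\zeta_{ij},z)E_{ij}\otimes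 E_{ji},$$ with matrix elements $R(\zeta,z)(e_a\otimes e_b)=\sum_{x,y}R^{ab}_{xy}(\zeta,z)\,e_x\otimes e_y$. Let $\mathcal F=\mathcal F_{\mathrm{ell}}(M(n))$ be the unital associative $\mathbb C$-algebra generated by $e_{ij}(z)$ ($1\le i,j\le n$, $z\in\mathbb C^\times$) and two copies of $M_{\mathfrak h^*}$, with elements written $f(\lambda)$ and $f(\rho)$ and commuting with each other, subject to $f(\lambda)e_{ij}(z)=e_{ij}(z)(T_{\omega(i)}f)(\lambda)$, $f(\rho)e_{ij}(z)=e_{ij}(z)(T_{\omega(j)}f)(\rho)$ and $$\sum_{x,y}\lim_{w\to z_1/z_2}\big(\varphi(w)R^{xy}_{ac}(\lambda,w)\big)e_{xb}(z_1)e_{yd}(z_2)=\sum_{x,y}\lim_{w\to z_1/z_2}\big(\varphi(w)R^{bd}_{xy}(\rho,w)\big)e_{cy}(z_2)e_{ax}(z_1)$$ for all $a,b,c,d$, all $z_1,z_2\in\mathbb C^\times$ and all meromorphic $\varphi$ on $\mathbb C^\times$ for which the limits exist. For $m\ge 0$ consider $V^{\otimes m}\otimes\mathcal F$. Let $\mathsf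 R^{ij}(\zeta,z)=\lim_{w\to z}\theta(q^2w)R(\zeta,w)^{(i,j)}$, acting on the tensor factors $i$ and $j$ of $V^{\otimes m}$, and let $\mathsf R^{ij}(\lambda,z)$, $\mathsf R^{ij}(\rho,z)$ be the operators on $V^{\otimes m}\otimes\mathcal F$ obtained by reading the matrix elements in $\mathcal F$ (as left multiplications) through $f\mapsto f(\lambda)$, resp. $f\mapsto f(\rho)$. Let $L^k(z)=\sum_{x,y}E_{xy}^{(k)}\otimes e_{xy}(z)$. In a dynamical argument, $h^k$ takes the value $\omega(a_k)$ on $e_{a_1}\otimes\dots\otimes e_{a_m}\otimes u$; put $h^{\ge k}=\sum_{j\ge k}h^j$, and similarly $h^{\le k}$, $h^{>k}$. Let $\mathcal E_m$ be the algebra of all functions $F:(\mathbb C^\times)^m\to\operatorname{End}(V^{\otimes m}\otimes\mathcal F)$, on which $S_m$ acts by $(\sigma F)(z)=\sigma\circ F(z_{\sigma(1)},\dots,z_{\sigma(m)})\circ\sigma^{-1}$ ($\sigma$ permuting tensor factors), and let $\mathcal E_m*S_m$ be the skew group algebra, $(F\otimes\sigma)(G\otimes\tau)=F\,\sigma(G)\otimes\sigma\tau$.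 Let $B_m$ be the positive braid monoid with generators $s_1,\dots,s_{m-1}$ and relations $s_is_{i+1}s_i=s_{i+1}s_is_{i+1}$, $s_is_j=s_js_i$ for $|i-j|>1$; let $\sigma_i=\pi(s_i)=(i\ \,i{+}1)$. For a word $w$ in the generators define $\mathsf C_w(\zeta,z)$, a function of $z \in (\mathbb C^\times)^m$ with values in the operators on $V^{\otimes m}$ depending meromorphically on $\zeta$, by $\mathsf C_1=1$ and $$\mathsf C_{s_iw}=\mathsf C_{s_i}\cdot\sigma_i(\mathsf C_w),\qquad \mathsf C_{s_i}(\zeta,z)=\mathsf R^{i,i+1}(\zeta-h^{\ge i+2},z_i/z_{i+1}).$$ Finally let $t_1=1$ and $t_d=t_{d-1}s_{d-1}s_{d-2}\cdots s_1$ for $2 \le d\le m$. **Statement.** (i) For every $m$ (in particular $m=n$), the assignment $W(s_i)=\mathsf R^{i,i+1}(\lambda-h^{\ge i+2},z_i/z_{i+1})\otimes\sigma_i$ extends to a morphism of monoids $W:B_m\to\mathcal E_m*S_m$, and $W(b)=\mathsf C_w(\lambda,z)\otimes\pi(b)$ for every word $w$ representing $b\in B_m$. The same holds with $\rho$ in place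 of $\lambda$. (ii) For $1\le d\le n$ and $z\in(\mathbb C^\times)^d$, on $V^{\otimes d}\otimes\mathcal F$, $$\mathsf C_{t_d}(\lambda,z)\,L^1(z_1)\cdots L^d(z_d)=L^d(z_d)\cdots L^1(z_1)\,\mathsf C_{t_d}(\rho+h^{\le d},z).$$ (iii) For $1\le d\le n$ and $z\in(\mathbb C^\times)^n$, on $V^{\otimes n}\otimes\mathcal F$ (where $\mathsf C_{t_d}(\lambda,z)$ contains the shift $-h^{>d}$), $$\mathsf C_{t_d}(\lambda+h^{>d},z)\,L^1(z_1)\cdots L^d(z_d)=L^d(z_d)\cdots L^1(z_1)\,\mathsf C_{t_d}(\rho+h^{\le n},z).$$ For $d=n$, (ii) and (iii) are the same relation. -/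

import Mathlib

open Filter Topology

noncomputable section

namespace EllipticRLL

/-! ## Parameters and theta functions -/

/-- Real numbers `0 < p, q < 1` that are generic: `p ^ a * q ^ b = 1` with integers `a`, `b`
only for `a = b = 0`. -/
structure EllipticParams where
  p : ℝ
  q : ℝ
  p_pos : 0 < p
  p_lt_one : p < 1
  q_pos : 0 < q
  q_lt_one : q < 1
  generic : ∀ a b : ℤ, p ^ a * q ^ b = 1 → a = 0 ∧ b = 0

/-- The normalized Jacobi theta function
`θ(z) = ∏_{j ≥ 0} (1 - z p ^ j) (1 - p ^ (j + 1) / z)`. -/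
def theta (P : EllipticParams) (z : ℂ) : ℂ :=
  ∏' j : ℕ, ((1 - z * (P.p : ℂ) ^ j) * (1 - (P.p : ℂ) ^ (j + 1) / z))

/-- `q ^ s` for complex `s` (the principal value, as `q > 0`). -/
def qpow (P : EllipticParams) (s : ℂ) : ℂ := (P.q : ℂ) ^ s

/-- The half-product `∏_{j ≥ 0} (1 - z p ^ j)`. -/
def halfTheta (P : EllipticParams) (z : ℂ) : ℂ := ∏' j : ℕ, (1 + -(z * (P.p : ℂ) ^ j))

lemma summable_norm_half (P : EllipticParams) (z : ℂ) :
    Summable fun j : ℕ => ‖-(z * (P.p : ℂ) ^ j)‖ := by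
  have : (fun j : ℕ => ‖-(z * (P.p : ℂ) ^ j)‖) = fun j : ℕ => ‖z‖ * P.p ^ j := by
    funext j
    simp [abs_of_pos P.p_pos]
  rw [this]
  exact (summable_geometric_of_lt_one P.p_pos.le P.p_lt_one).mul_left _

lemma theta_eq (P : EllipticParams) (z : ℂ) :
    theta P z = halfTheta P z * halfTheta P (P.p / z) := by
  unfold theta halfTheta
  rw [← Multipliable.tprod_mul (multipliable_one_add_of_summable (summable_norm_half P z))
    (multipliable_one_add_of_summable (summable_norm_half P (P.p / z)))]
  congr 1
  funext j
  ring

lemma differentiable_halfTheta (P : EllipticParams) : Differentiable ℂ (halfTheta P) := by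
  intro z
  have hu : Summable fun j : ℕ => (‖z‖ + 1) * P.p ^ j :=
    (summable_geometric_of_lt_one P.p_pos.le P.p_lt_one).mul_left _
  have h := Summable.hasProdLocallyUniformlyOn_nat_one_add
    (f := fun (j : ℕ) (x : ℂ) => -(x * (P.p : ℂ) ^ j)) (K := Metric.ball 0 (‖z‖ + 1))
    Metric.isOpen_ball hu
    (Eventually.of_forall fun j x hx => by
      have hx1 : ‖x‖ ≤ ‖z‖ + 1 := by
        have := Metric.mem_ball.1 hx
        rw [dist_zero_right] at this
        exact this.le
      have : ‖-(x * (P.p : ℂ) ^ j)‖ = ‖x‖ * P.p ^ j := by simp [abs_of_pos P.p_pos]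
      rw [this]
      exact mul_le_mul_of_nonneg_right hx1 (pow_nonneg P.p_pos.le _))
    (fun j => by fun_prop)
  have h2 := TendstoLocallyUniformlyOn.differentiableOn h
    (Eventually.of_forall fun s => by
      have : Differentiable ℂ (fun x : ℂ => ∏ i ∈ s, (1 + -(x * (P.p : ℂ) ^ i))) := by
        fun_prop
      exact this.differentiableOn) Metric.isOpen_ball
  exact h2.differentiableAt (Metric.isOpen_ball.mem_nhds (by simp))

lemma analyticAt_theta (P : EllipticParams) {z : ℂ} (hz : z ≠ 0) : AnalyticAt ℂ (theta P) z := by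
  have h1 : theta P = fun z => halfTheta P z * halfTheta P (P.p / z) := funext (theta_eq P)
  rw [h1]
  have ha : ∀ w, AnalyticAt ℂ (halfTheta P) w := fun w =>
    (differentiable_halfTheta P).analyticAt w
  exact (ha z).mul ((ha _).comp_of_eq (analyticAt_const.div analyticAt_id hz) rfl)

lemma qpow_ne_zero (P : EllipticParams) (s : ℂ) : qpow P s ≠ 0 := by
  have : (P.q : ℂ) ≠ 0 := by exact_mod_cast P.q_pos.ne'
  simp [qpow, Complex.cpow_eq_zero_iff, this]

lemma q_ne_zero (P : EllipticParams) : (P.q : ℂ) ≠ 0 := by exact_mod_cast P.q_pos.ne'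

lemma theta_neg_one_ne_zero (P : EllipticParams) : theta P (-1) ≠ 0 := by
  have key : ∀ t : ℝ, 0 < t → halfTheta P (-(t : ℂ)) ≠ 0 := by
    intro t ht
    refine tprod_one_add_ne_zero_of_summable (fun j => ?_) (summable_norm_half P _)
    have : (1 : ℂ) + -(-(t : ℂ) * (P.p : ℂ) ^ j) = ((1 + t * P.p ^ j : ℝ) : ℂ) := by
      push_cast
      ring
    rw [this]
    have h3 := P.p_pos
    have : (0 : ℝ) < 1 + t * P.p ^ j := by positivity
    exact_mod_cast this.ne'
  rw [theta_eq]
  refine mul_ne_zero ?_ ?_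
  · simpa using key 1 one_pos
  · have := key P.p P.p_pos
    rwa [show (P.p : ℂ) / (-1) = -(P.p : ℂ) by ring]

lemma theta_eventually_ne_zero (P : EllipticParams) {z : ℂ} (hz : z ≠ 0) :
    ∀ᶠ w in 𝓝[≠] z, theta P w ≠ 0 := by
  rcases (analyticAt_theta P hz).eventually_eq_zero_or_eventually_ne_zero with h | h
  · exfalso
    have hU : IsPreconnected ({0}ᶜ : Set ℂ) :=
      (isConnected_compl_singleton_of_one_lt_rank (by simp) (0 : ℂ)).isPreconnected
    have han : AnalyticOnNhd ℂ (theta P) ({0}ᶜ : Set ℂ) := fun w hw => analyticAt_theta P hw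
    have := han.eqOn_zero_of_preconnected_of_eventuallyEq_zero hU (z₀ := z) (by simpa using hz) h
    exact theta_neg_one_ne_zero P (this (by simp : (-1 : ℂ) ∈ ({0}ᶜ : Set ℂ)))
  · exact h

/-! ## Meromorphic functions of several variables -/

section Meromorphic

variable {E : Type} [NormedAddCommGroup E] [NormedSpace ℂ E]

/-- `f` is meromorphic: near each point it is a quotient `g / h` of holomorphic functions with
`h` not locally zero.  Values at the zeros of `h` are irrelevant. -/
def IsMero (f : E → ℂ) : Prop :=
  ∀ x : E, ∃ g h : E → ℂ, AnalyticAt ℂ g x ∧ AnalyticAt ℂ h x ∧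
    (¬ ∀ᶠ y in 𝓝 x, h y = 0) ∧ ∀ᶠ y in 𝓝 x, h y ≠ 0 → f y = g y / h y

lemma eventually_zero_of_mul {g h : E → ℂ} {x : E} (hg : AnalyticAt ℂ g x)
    (hh : AnalyticAt ℂ h x) (hg0 : ¬ ∀ᶠ y in 𝓝 x, g y = 0) (hh0 : ¬ ∀ᶠ y in 𝓝 x, h y = 0) :
    ¬ ∀ᶠ y in 𝓝 x, g y * h y = 0 := by
  intro H
  obtain ⟨r, hr, hball⟩ := Metric.eventually_nhds_iff_ball.1
    (H.and (hg.eventually_analyticAt.and hh.eventually_analyticAt))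
  have hx : x ∈ Metric.ball x r := Metric.mem_ball_self hr
  have hmem : Metric.ball x r ∈ 𝓝 x := Metric.ball_mem_nhds x hr
  obtain ⟨y, hy, hgy⟩ : ∃ y ∈ Metric.ball x r, g y ≠ 0 := by
    by_contra hcon
    push Not at hcon
    exact hg0 (Filter.mem_of_superset hmem hcon)
  have h1 : ∀ᶠ w in 𝓝 y, h w = 0 := by
    filter_upwards [(hball y hy).2.1.continuousAt.eventually_ne hgy,
      Metric.isOpen_ball.mem_nhds hy] with w hw hwb
    exact (mul_eq_zero.1 (hball w hwb).1).resolve_left hw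
  have hU : IsPreconnected (Metric.ball x r) := by
    let _ : NormedSpace ℝ E := NormedSpace.restrictScalars ℝ ℂ E
    exact (convex_ball x r).isPreconnected
  have han : AnalyticOnNhd ℂ h (Metric.ball x r) := fun w hw => (hball w hw).2.2
  have h2 := han.eqOn_zero_of_preconnected_of_eventuallyEq_zero hU hy h1
  exact hh0 (Filter.mem_of_superset hmem h2)

lemma IsMero.of_div {g h : E → ℂ} (hg : ∀ x, AnalyticAt ℂ g x) (hh : ∀ x, AnalyticAt ℂ h x) :
    IsMero fun x => g x / h x := by
  intro x
  by_cases H : ∀ᶠ y in 𝓝 x, h y = 0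
  · refine ⟨fun _ => 0, fun _ => 1, analyticAt_const, analyticAt_const,
      by simpa using (inferInstance : (𝓝 x).NeBot).ne, ?_⟩
    filter_upwards [H] with y hy _
    simp [hy]
  · exact ⟨g, h, hg x, hh x, H, Eventually.of_forall fun y _ => rfl⟩

lemma IsMero.of_analytic {g : E → ℂ} (hg : ∀ x, AnalyticAt ℂ g x) : IsMero g := by
  simpa using IsMero.of_div hg (h := fun _ => 1) (fun _ => analyticAt_const)

lemma IsMero.add {f₁ f₂ : E → ℂ} (h₁ : IsMero f₁) (h₂ : IsMero f₂) : IsMero (f₁ + f₂) := by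
  intro x
  obtain ⟨g, h, hg, hh, hh0, hf⟩ := h₁ x
  obtain ⟨g', h', hg', hh', hh0', hf'⟩ := h₂ x
  refine ⟨fun y => g y * h' y + h y * g' y, fun y => h y * h' y, (hg.mul hh').add (hh.mul hg'),
    hh.mul hh', eventually_zero_of_mul hh hh' hh0 hh0', ?_⟩
  filter_upwards [hf, hf'] with y hy hy' hne
  have h1 := left_ne_zero_of_mul hne
  have h2 := right_ne_zero_of_mul hne
  rw [Pi.add_apply, hy h1, hy' h2, div_add_div _ _ h1 h2]

lemma IsMero.mul {f₁ f₂ : E → ℂ} (h₁ : IsMero f₁) (h₂ : IsMero f₂) : IsMero (f₁ * f₂) := by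
  intro x
  obtain ⟨g, h, hg, hh, hh0, hf⟩ := h₁ x
  obtain ⟨g', h', hg', hh', hh0', hf'⟩ := h₂ x
  refine ⟨fun y => g y * g' y, fun y => h y * h' y, hg.mul hg',
    hh.mul hh', eventually_zero_of_mul hh hh' hh0 hh0', ?_⟩
  filter_upwards [hf, hf'] with y hy hy' hne
  have h1 := left_ne_zero_of_mul hne
  have h2 := right_ne_zero_of_mul hne
  rw [Pi.mul_apply, hy h1, hy' h2, div_mul_div_comm]

lemma IsMero.comp_add {f : E → ℂ} (hf : IsMero f) (α : E) : IsMero fun x => f (x + α) := by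
  intro x
  obtain ⟨g, h, hg, hh, hh0, hq⟩ := hf (x + α)
  have hlin : AnalyticAt ℂ (fun y : E => y + α) x := analyticAt_id.add analyticAt_const
  have hmap : map (fun y : E => y + α) (𝓝 x) = 𝓝 (x + α) := (Homeomorph.addRight α).map_nhds_eq x
  refine ⟨fun y => g (y + α), fun y => h (y + α), hg.comp_of_eq hlin rfl,
    hh.comp_of_eq hlin rfl, ?_, ?_⟩
  · intro H
    apply hh0
    rw [← hmap]
    exact H
  · rw [← hmap] at hq
    exact hq

end Meromorphic

section MeroRing

variable (E : Type) [NormedAddCommGroup E] [NormedSpace ℂ E]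

/-- The algebra of (everywhere defined representatives of) meromorphic functions. -/
def meroSubalgebra : Subalgebra ℂ (E → ℂ) where
  carrier := {f | IsMero f}
  mul_mem' h₁ h₂ := h₁.mul h₂
  add_mem' h₁ h₂ := h₁.add h₂
  algebraMap_mem' _ := IsMero.of_analytic fun _ => analyticAt_const

/-- The ideal of representatives vanishing at generic points (outside a meagre set). -/
def meroNull : Ideal (meroSubalgebra E) where
  carrier := {f | ∀ᶠ x in residual E, f.1 x = 0}
  zero_mem' := by
    change ∀ᶠ x in residual E, (0 : ℂ) = 0
    exact Eventually.of_forall fun _ => rfl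
  add_mem' {f g} hf hg := by
    change ∀ᶠ x in residual E, f.1 x = 0 at hf
    change ∀ᶠ x in residual E, g.1 x = 0 at hg
    change ∀ᶠ x in residual E, (f + g).1 x = 0
    filter_upwards [hf, hg] with x hx hy
    change f.1 x + g.1 x = 0
    rw [hx, hy, add_zero]
  smul_mem' c f hf := by
    change ∀ᶠ x in residual E, f.1 x = 0 at hf
    change ∀ᶠ x in residual E, (c * f).1 x = 0
    filter_upwards [hf] with x hx
    change c.1 x * f.1 x = 0
    rw [hx, mul_zero]

/-- The algebra of meromorphic functions on `E`: two representatives are identified when they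
agree at generic points. -/
abbrev Mero : Type := meroSubalgebra E ⧸ meroNull E

variable {E}

/-- The meromorphic function represented by `f`. -/
def Mero.mk (f : E → ℂ) (hf : IsMero f) : Mero E := Ideal.Quotient.mk (meroNull E) ⟨f, hf⟩

/-- Translation of representatives. -/
def meroTranslate (α : E) : meroSubalgebra E →ₐ[ℂ] meroSubalgebra E where
  toFun f := ⟨fun x => f.1 (x + α), IsMero.comp_add f.2 α⟩
  map_one' := rfl
  map_mul' _ _ := rfl
  map_zero' := rfl
  map_add' _ _ := rfl
  commutes' _ := rfl

/-- The automorphism `(T_α f)(ζ) = f(ζ + α)` of the algebra of meromorphic functions. -/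
def T (α : E) : Mero E →ₐ[ℂ] Mero E :=
  Ideal.quotientMapₐ (meroNull E) (meroTranslate α) (by
    intro f hf
    have h : ∀ᶠ x in map (Homeomorph.addRight α) (residual E), f.1 x = 0 := by
      rw [Homeomorph.residual_map_eq]
      exact hf
    exact h)

/-- `g` is the limit as `w → z`, `w ≠ z`, of the family `F w`: the limit is taken pointwise at
generic points. -/
def IsSpecLimit (F : ℂ → E → ℂ) (z : ℂ) (g : Mero E) : Prop :=
  ∃ (f : E → ℂ) (hf : IsMero f), Mero.mk f hf = g ∧
    ∀ᶠ ζ in residual E, Tendsto (fun w => F w ζ) (𝓝[≠] z) (𝓝 (f ζ))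

end MeroRing

/-! ## The Cartan subalgebra of `sl(n)` and the elliptic R-matrix -/

/-- The Cartan subalgebra of `sl(n)`: the traceless diagonal matrices `diag(h_1, …, h_n)`, encoded
by their diagonals. -/
def Cartan (n : ℕ) : Submodule ℂ (Fin n → ℂ) where
  carrier := {h | ∑ i, h i = 0}
  zero_mem' := by simp
  add_mem' {a b} ha hb := by
    have ha' : ∑ i, a i = 0 := ha
    have hb' : ∑ i, b i = 0 := hb
    simp [Finset.sum_add_distrib, ha', hb']
  smul_mem' c a ha := by
    have ha' : ∑ i, a i = 0 := ha
    simp [← Finset.mul_sum, ha']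

/-- The dual space of the Cartan subalgebra (all linear forms are continuous). -/
abbrev CartanDual (n : ℕ) : Type := Cartan n →L[ℂ] ℂ

/-- The weight `ω(i)`, `ω(i)(h) = h_i`. -/
def omega {n : ℕ} (i : Fin n) : CartanDual n :=
  (ContinuousLinearMap.proj i).comp (Cartan n).subtypeL

/-- The element `E_ii - E_jj` of the Cartan subalgebra. -/
def coroot {n : ℕ} (i j : Fin n) : Cartan n :=
  ⟨Pi.single i 1 - Pi.single j 1, by
    change ∑ k, (Pi.single i 1 - Pi.single j 1 : Fin n → ℂ) k = 0
    simp⟩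

/-- `λ_ij = λ(E_ii - E_jj)`. -/
def pair {n : ℕ} (l : CartanDual n) (i j : Fin n) : ℂ := l (coroot i j)

/-- `α(s, z) = θ(z) θ(q ^ (2 (s + 1))) / (θ(q ^ 2 z) θ(q ^ (2 s)))`. -/
def alpha (P : EllipticParams) (s z : ℂ) : ℂ :=
  theta P z * theta P (qpow P (2 * (s + 1))) /
    (theta P ((P.q : ℂ) ^ 2 * z) * theta P (qpow P (2 * s)))

/-- `β(s, z) = θ(q ^ 2) θ(q ^ (-2 s) z) / (θ(q ^ 2 z) θ(q ^ (-2 s)))`. -/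
def beta (P : EllipticParams) (s z : ℂ) : ℂ :=
  theta P ((P.q : ℂ) ^ 2) * theta P (qpow P (-2 * s) * z) /
    (theta P ((P.q : ℂ) ^ 2 * z) * theta P (qpow P (-2 * s)))

/-- The matrix elements `R_{xy}^{ab}(ζ, z)` of
`R(ζ, z) = ∑_i E_ii ⊗ E_ii + ∑_{i ≠ j} α(ζ_ij, z) E_ii ⊗ E_jj + ∑_{i ≠ j} β(ζ_ij, z) E_ij ⊗ E_ji`,
that is, `R(ζ, z) (e_a ⊗ e_b) = ∑_{x, y} R_{xy}^{ab}(ζ, z) e_x ⊗ e_y`. -/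
def Rcoef (P : EllipticParams) {n : ℕ} (x y a b : Fin n) (z : ℂ) (ζ : CartanDual n) : ℂ :=
  if a = b then (if x = a ∧ y = a then 1 else 0)
  else if x = a ∧ y = b then alpha P (pair ζ x y) z
  else if x = b ∧ y = a then beta P (pair ζ x y) z
  else 0

/-- The matrix elements of the regularized R-matrix, `lim_{w → z} θ(q ^ 2 w) R_{xy}^{ab}(ζ, w)`,
with the factor `θ(q ^ 2 w)` cancelled (see `isSpecLimit_regR`). -/
def regRcoef (P : EllipticParams) {n : ℕ} (x y a b : Fin n) (z : ℂ) (ζ : CartanDual n) : ℂ :=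
  if a = b then (if x = a ∧ y = a then theta P ((P.q : ℂ) ^ 2 * z) else 0)
  else if x = a ∧ y = b then
    theta P z * theta P (qpow P (2 * (pair ζ x y + 1))) / theta P (qpow P (2 * pair ζ x y))
  else if x = b ∧ y = a then
    theta P ((P.q : ℂ) ^ 2) * theta P (qpow P (-2 * pair ζ x y) * z) /
      theta P (qpow P (-2 * pair ζ x y))
  else 0

lemma analyticAt_pair {n : ℕ} (i j : Fin n) (ζ : CartanDual n) :
    AnalyticAt ℂ (fun ζ : CartanDual n => pair ζ i j) ζ := by
  let φ : CartanDual n →L[ℂ] ℂ := ContinuousLinearMap.apply ℂ ℂ (coroot i j)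
  exact ContinuousLinearMap.analyticAt (𝕜 := ℂ) (E := CartanDual n) (F := ℂ) φ ζ

lemma analyticAt_theta_qpow (P : EllipticParams) {E : Type} [NormedAddCommGroup E]
    [NormedSpace ℂ E] {s : E → ℂ} {x : E} (hs : AnalyticAt ℂ s x) {z : ℂ} (hz : z ≠ 0) :
    AnalyticAt ℂ (fun y => theta P (qpow P (s y) * z)) x := by
  have h1 : AnalyticAt ℂ (fun y => qpow P (s y) * z) x := by
    have h2 : (fun y => qpow P (s y) * z) =
        fun y => Complex.exp (Complex.log (P.q : ℂ) * s y) * z := by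
      funext y
      rw [qpow, Complex.cpow_def_of_ne_zero (q_ne_zero P)]
    rw [h2]
    exact ((analyticAt_const.mul hs).cexp).mul analyticAt_const
  exact (analyticAt_theta P (mul_ne_zero (qpow_ne_zero P _) hz)).comp_of_eq h1 rfl

lemma isMero_regRcoef (P : EllipticParams) {n : ℕ} (x y a b : Fin n) (z : ℂˣ) :
    IsMero (regRcoef P x y a b (z : ℂ) : CartanDual n → ℂ) := by
  have hp := fun ζ => analyticAt_pair x y ζ
  have h1 := fun (ζ : CartanDual n) => analyticAt_theta_qpow P
    ((analyticAt_const (v := (2 : ℂ))).mul ((hp ζ).add (analyticAt_const (v := (1 : ℂ)))))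
    one_ne_zero
  have h2 := fun (ζ : CartanDual n) => analyticAt_theta_qpow P
    ((analyticAt_const (v := (2 : ℂ))).mul (hp ζ)) one_ne_zero
  have h3 := fun (ζ : CartanDual n) => analyticAt_theta_qpow P
    ((analyticAt_const (v := (-2 : ℂ))).mul (hp ζ)) one_ne_zero
  have h4 := fun (ζ : CartanDual n) => analyticAt_theta_qpow P
    ((analyticAt_const (v := (-2 : ℂ))).mul (hp ζ)) z.ne_zero
  simp only [mul_one] at h1 h2 h3
  unfold regRcoef
  split_ifs
  · exact IsMero.of_analytic fun _ => analyticAt_const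
  · exact IsMero.of_analytic fun _ => analyticAt_const
  · exact IsMero.of_div (fun ζ => analyticAt_const.mul (h1 ζ)) h2
  · exact IsMero.of_div (fun ζ => analyticAt_const.mul (h4 ζ)) h3
  · exact IsMero.of_analytic fun _ => analyticAt_const

/-- The regularized matrix elements as meromorphic functions of the dynamical variable. -/
def regR (P : EllipticParams) {n : ℕ} (x y a b : Fin n) (z : ℂˣ) : Mero (CartanDual n) :=
  Mero.mk (regRcoef P x y a b (z : ℂ)) (isMero_regRcoef P x y a b z)

/-- `regR` is the limit of `θ(q ^ 2 w) R_{xy}^{ab}(ζ, w)` as `w → z`. -/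
theorem isSpecLimit_regR (P : EllipticParams) {n : ℕ} (x y a b : Fin n) (z : ℂˣ) :
    IsSpecLimit (fun w ζ => theta P ((P.q : ℂ) ^ 2 * w) * Rcoef P x y a b w ζ) (z : ℂ)
      (regR P x y a b z) := by
  refine ⟨_, isMero_regRcoef P x y a b z, rfl, Eventually.of_forall fun ζ => ?_⟩
  have hq2 : (P.q : ℂ) ^ 2 ≠ 0 := pow_ne_zero 2 (q_ne_zero P)
  have hz := z.ne_zero
  have hlin : ContinuousAt (fun w : ℂ => (P.q : ℂ) ^ 2 * w) (z : ℂ) := by fun_prop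
  have hth : ContinuousAt (theta P) (z : ℂ) := (analyticAt_theta P hz).continuousAt
  have hth2 : ContinuousAt (fun w => theta P ((P.q : ℂ) ^ 2 * w)) (z : ℂ) :=
    ContinuousAt.comp' (analyticAt_theta P (mul_ne_zero hq2 hz)).continuousAt hlin
  have hth3 : ∀ c : ℂ, c ≠ 0 → ContinuousAt (fun w => theta P (c * w)) (z : ℂ) := fun c hc =>
    ContinuousAt.comp' (f := fun w => c * w)
      (analyticAt_theta P (mul_ne_zero hc hz)).continuousAt (by fun_prop)
  have hne : ∀ᶠ w in 𝓝[≠] (z : ℂ), theta P ((P.q : ℂ) ^ 2 * w) ≠ 0 := by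
    have h := theta_eventually_ne_zero P (mul_ne_zero hq2 hz)
    refine Tendsto.eventually (f := fun w => (P.q : ℂ) ^ 2 * w) ?_ h
    refine tendsto_nhdsWithin_iff.2 ⟨hlin.tendsto.mono_left nhdsWithin_le_nhds, ?_⟩
    filter_upwards [self_mem_nhdsWithin] with w hw
    simpa [hq2, q_ne_zero P] using hw
  have main : ∀ F G : ℂ → ℂ, ContinuousAt G (z : ℂ) →
      (∀ w, theta P ((P.q : ℂ) ^ 2 * w) ≠ 0 → theta P ((P.q : ℂ) ^ 2 * w) * F w = G w) →
      Tendsto (fun w => theta P ((P.q : ℂ) ^ 2 * w) * F w) (𝓝[≠] (z : ℂ)) (𝓝 (G z)) := by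
    intro F G hG hFG
    refine (hG.tendsto.mono_left nhdsWithin_le_nhds).congr' ?_
    filter_upwards [hne] with w hw
    exact (hFG w hw).symm
  unfold Rcoef regRcoef
  split_ifs
  · exact main (fun _ => 1) (fun w => theta P ((P.q : ℂ) ^ 2 * w)) hth2 (by simp)
  · simp
  · refine main (fun w => alpha P (pair ζ x y) w) (fun w => theta P w *
      theta P (qpow P (2 * (pair ζ x y + 1))) / theta P (qpow P (2 * pair ζ x y)))
      ((hth.mul continuousAt_const).div_const _) fun w hw => ?_
    rw [alpha]
    field_simp
  · refine main (fun w => beta P (pair ζ x y) w) (fun w => theta P ((P.q : ℂ) ^ 2) *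
      theta P (qpow P (-2 * pair ζ x y) * w) / theta P (qpow P (-2 * pair ζ x y)))
      ((continuousAt_const.mul (hth3 _ (qpow_ne_zero P _))).div_const _) fun w hw => ?_
    rw [beta]
    field_simp
  · simp

/-! ## The algebra `F_ell(M(n))` -/

/-- Generators: `e_ij(z)` and two copies `f(λ)`, `f(ρ)` of the meromorphic functions. -/
inductive Gen (n : ℕ) : Type
  | e : Fin n → Fin n → ℂˣ → Gen n
  | l : Mero (CartanDual n) → Gen n
  | r : Mero (CartanDual n) → Gen n

/-- The free generators inside the free algebra. -/
abbrev gE {n : ℕ} (i j : Fin n) (z : ℂˣ) : FreeAlgebra ℂ (Gen n) := FreeAlgebra.ι ℂ (Gen.e i j z)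

/-- The free generator for `f(λ)`. -/
abbrev gL {n : ℕ} (f : Mero (CartanDual n)) : FreeAlgebra ℂ (Gen n) := FreeAlgebra.ι ℂ (Gen.l f)

/-- The free generator for `f(ρ)`. -/
abbrev gR {n : ℕ} (f : Mero (CartanDual n)) : FreeAlgebra ℂ (Gen n) := FreeAlgebra.ι ℂ (Gen.r f)

/-- The defining relations of `F_ell(M(n))`: `f ↦ f(λ)` and `f ↦ f(ρ)` are algebra maps with
commuting images, they move past `e_ij(z)` by translation, and all regularized RLL relations hold,
that is, those of the form
`∑_{x,y} lim_{w → z₁/z₂} (φ(w) R_{ac}^{xy}(λ, w)) e_xb(z₁) e_yd(z₂)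
  = ∑_{x,y} lim_{w → z₁/z₂} (φ(w) R_{xy}^{bd}(ρ, w)) e_cy(z₂) e_ax(z₁)`
with `φ` meromorphic on the punctured plane such that the limits exist. -/
inductive Rel (P : EllipticParams) (n : ℕ) :
    FreeAlgebra ℂ (Gen n) → FreeAlgebra ℂ (Gen n) → Prop
  | l_algebraMap (c : ℂ) : Rel P n (gL (algebraMap ℂ _ c)) (algebraMap ℂ _ c)
  | l_add (f g : Mero (CartanDual n)) : Rel P n (gL (f + g)) (gL f + gL g)
  | l_mul (f g : Mero (CartanDual n)) : Rel P n (gL (f * g)) (gL f * gL g)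
  | r_algebraMap (c : ℂ) : Rel P n (gR (algebraMap ℂ _ c)) (algebraMap ℂ _ c)
  | r_add (f g : Mero (CartanDual n)) : Rel P n (gR (f + g)) (gR f + gR g)
  | r_mul (f g : Mero (CartanDual n)) : Rel P n (gR (f * g)) (gR f * gR g)
  | l_r_comm (f g : Mero (CartanDual n)) : Rel P n (gL f * gR g) (gR g * gL f)
  | l_e (f : Mero (CartanDual n)) (i j : Fin n) (z : ℂˣ) :
      Rel P n (gL f * gE i j z) (gE i j z * gL (T (omega i) f))
  | r_e (f : Mero (CartanDual n)) (i j : Fin n) (z : ℂˣ) :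
      Rel P n (gR f * gE i j z) (gE i j z * gR (T (omega j) f))
  | rll (a b c d : Fin n) (z₁ z₂ : ℂˣ) (φ : ℂ → ℂ) (hφ : MeromorphicOn φ {0}ᶜ)
      (A B : Fin n → Fin n → Mero (CartanDual n))
      (hA : ∀ x y, IsSpecLimit (fun w ζ => φ w * Rcoef P a c x y w ζ) ((z₁ / z₂ : ℂˣ) : ℂ) (A x y))
      (hB : ∀ x y, IsSpecLimit (fun w ζ => φ w * Rcoef P x y b d w ζ) ((z₁ / z₂ : ℂˣ) : ℂ) (B x y)) :
      Rel P n (∑ x, ∑ y, gL (A x y) * gE x b z₁ * gE y d z₂)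
        (∑ x, ∑ y, gR (B x y) * gE c y z₂ * gE a x z₁)

/-- The algebra `F_ell(M(n))`. -/
def FellM (P : EllipticParams) (n : ℕ) : Type := RingQuot (Rel P n)

instance (P : EllipticParams) (n : ℕ) : Ring (FellM P n) :=
  inferInstanceAs (Ring (RingQuot (Rel P n)))

instance (P : EllipticParams) (n : ℕ) : Algebra ℂ (FellM P n) :=
  inferInstanceAs (Algebra ℂ (RingQuot (Rel P n)))

/-- The quotient map from the free algebra. -/
def FellM.mk (P : EllipticParams) (n : ℕ) : FreeAlgebra ℂ (Gen n) →ₐ[ℂ] FellM P n :=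
  RingQuot.mkAlgHom ℂ (Rel P n)

lemma FellM.mk_rel {P : EllipticParams} {n : ℕ} {x y : FreeAlgebra ℂ (Gen n)} (h : Rel P n x y) :
    FellM.mk P n x = FellM.mk P n y :=
  RingQuot.mkAlgHom_rel ℂ h

/-- The generator `e_ij(z)`. -/
def eGen (P : EllipticParams) {n : ℕ} (i j : Fin n) (z : ℂˣ) : FellM P n := FellM.mk P n (gE i j z)

/-- The two moment maps: `lam` stands for `f ↦ f(λ)` and `rho` for `f ↦ f(ρ)`. -/
inductive Side : Type
  | lam : Side
  | rho : Side

/-- The moment maps `f ↦ f(λ)` and `f ↦ f(ρ)`. -/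
def moment (P : EllipticParams) (n : ℕ) : Side → (Mero (CartanDual n) →ₐ[ℂ] FellM P n)
  | .lam =>
    { toFun := fun f => FellM.mk P n (gL f)
      map_one' := by
        have := FellM.mk_rel (Rel.l_algebraMap (P := P) (n := n) 1)
        rwa [map_one, map_one, map_one] at this
      map_zero' := by
        have := FellM.mk_rel (Rel.l_algebraMap (P := P) (n := n) 0)
        rwa [map_zero, map_zero, map_zero] at this
      map_add' := fun f g => by rw [FellM.mk_rel (Rel.l_add f g), map_add]
      map_mul' := fun f g => by rw [FellM.mk_rel (Rel.l_mul f g), map_mul]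
      commutes' := fun c => by rw [FellM.mk_rel (Rel.l_algebraMap c), AlgHom.commutes] }
  | .rho =>
    { toFun := fun f => FellM.mk P n (gR f)
      map_one' := by
        have := FellM.mk_rel (Rel.r_algebraMap (P := P) (n := n) 1)
        rwa [map_one, map_one, map_one] at this
      map_zero' := by
        have := FellM.mk_rel (Rel.r_algebraMap (P := P) (n := n) 0)
        rwa [map_zero, map_zero, map_zero] at this
      map_add' := fun f g => by rw [FellM.mk_rel (Rel.r_add f g), map_add]
      map_mul' := fun f g => by rw [FellM.mk_rel (Rel.r_mul f g), map_mul]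
      commutes' := fun c => by rw [FellM.mk_rel (Rel.r_algebraMap c), AlgHom.commutes] }

/-! ## Operators on `V^{⊗ m} ⊗ F_ell(M(n))`, where `V = ℂ ^ n` -/

/-- Labels `a = (a_1, …, a_m)` of the basis vectors `e_{a_1} ⊗ ⋯ ⊗ e_{a_m}` of `V^{⊗ m}`. -/
abbrev Idx (n m : ℕ) : Type := Fin m → Fin n

/-- `V^{⊗ m} ⊗ F_ell(M(n))`: the function `v` stands for `∑_a e_{a_1} ⊗ ⋯ ⊗ e_{a_m} ⊗ v(a)`. -/
abbrev TensorF (P : EllipticParams) (n m : ℕ) : Type := Idx n m → FellM P n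

/-- The algebra `End(V^{⊗ m} ⊗ F_ell(M(n)))` of linear operators. -/
abbrev Op (P : EllipticParams) (n m : ℕ) : Type := Module.End ℂ (TensorF P n m)

/-- Operators on `V^{⊗ m}` depending meromorphically on the dynamical variable `ζ`, by their
matrix elements: `A(ζ) e_a = ∑_b A(ζ)_{b a} e_b`. -/
abbrev DynOp (n m : ℕ) : Type := Matrix (Idx n m) (Idx n m) (Mero (CartanDual n))

/-- The operator `A(λ)` or `A(ρ)`, `e_a ⊗ u ↦ ∑_b e_b ⊗ A_{b a}(λ) u`, resp. with `ρ`. -/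
def realize (P : EllipticParams) {n m : ℕ} (s : Side) (A : DynOp n m) : Op P n m where
  toFun v b := ∑ a, moment P n s (A b a) * v a
  map_add' v w := by
    funext b
    simp [mul_add, Finset.sum_add_distrib]
  map_smul' c v := by
    funext b
    simp [Finset.smul_sum]

/-- The substitution `ζ ↦ ζ + ∑_k c_k h^k` in `A(ζ)`: on a basis vector `e_a` the symbol `h^k`
takes the value `ω(a_k)`, the weight of the `k`-th tensor factor. -/
def shift {n m : ℕ} (c : Fin m → ℤ) (A : DynOp n m) : DynOp n m :=
  fun b a => T (∑ k, c k • omega (a k)) (A b a)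

/-- The regularized R-matrix acting on the tensor factors `i` and `j`,
`lim_{w → z} θ(q ^ 2 w) R(ζ, w)^{(i, j)}`. -/
def legR (P : EllipticParams) {n m : ℕ} (i j : Fin m) (z : ℂˣ) : DynOp n m :=
  fun b a => if ∀ k, k ≠ i → k ≠ j → b k = a k then regR P (b i) (b j) (a i) (a j) z else 0

/-- `L^k(z)`: the operator `L(z) = ∑_{x,y} E_xy ⊗ e_xy(z)` acting on the `k`-th tensor factor and
on `F_ell(M(n))` by left multiplication. -/
def Lop (P : EllipticParams) {n m : ℕ} (k : Fin m) (z : ℂˣ) : Op P n m where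
  toFun v b := ∑ y, eGen P (b k) y z * v (Function.update b k y)
  map_add' v w := by
    funext b
    simp [mul_add, Finset.sum_add_distrib]
  map_smul' c v := by
    funext b
    simp [Finset.smul_sum]

/-- `L^1(z_1) L^2(z_2) ⋯ L^d(z_d)` on `V^{⊗ m} ⊗ F_ell(M(n))`. -/
def Lprod (P : EllipticParams) (n : ℕ) {m : ℕ} (d : ℕ) (hd : d ≤ m) (z : Fin m → ℂˣ) : Op P n m :=
  (List.ofFn fun k : Fin d => Lop P (Fin.castLE hd k) (z (Fin.castLE hd k))).prod

/-- `L^d(z_d) ⋯ L^2(z_2) L^1(z_1)` on `V^{⊗ m} ⊗ F_ell(M(n))`. -/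
def LprodRev (P : EllipticParams) (n : ℕ) {m : ℕ} (d : ℕ) (hd : d ≤ m) (z : Fin m → ℂˣ) :
    Op P n m :=
  (List.ofFn fun k : Fin d => Lop P (Fin.castLE hd k) (z (Fin.castLE hd k))).reverse.prod

/-! ## The skew group algebra -/

/-- Permutation of the tensor factors: `σ` moves the `k`-th factor to position `σ(k)`. -/
def permOp (P : EllipticParams) (n : ℕ) {m : ℕ} (σ : Equiv.Perm (Fin m)) : Op P n m :=
  LinearMap.funLeft ℂ (FellM P n) fun b : Idx n m => b ∘ σ

lemma permOp_one (P : EllipticParams) (n m : ℕ) :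
    permOp P n (1 : Equiv.Perm (Fin m)) = 1 := rfl

lemma permOp_mul (P : EllipticParams) (n : ℕ) {m : ℕ} (σ τ : Equiv.Perm (Fin m)) :
    permOp P n (σ * τ) = permOp P n σ * permOp P n τ := rfl

/-- The algebra of all functions `(ℂ^×)^m → End(V^{⊗ m} ⊗ F_ell(M(n)))`. -/
def OpFun (P : EllipticParams) (n m : ℕ) : Type := (Fin m → ℂˣ) → Op P n m

instance (P : EllipticParams) (n m : ℕ) : Ring (OpFun P n m) :=
  inferInstanceAs (Ring ((Fin m → ℂˣ) → Op P n m))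

instance (P : EllipticParams) (n m : ℕ) : Algebra ℂ (OpFun P n m) :=
  inferInstanceAs (Algebra ℂ ((Fin m → ℂˣ) → Op P n m))

/-- The action `σ(F)(z) = σ ∘ F(σ(z)) ∘ σ⁻¹` of the symmetric group, with
`σ(z) = (z_{σ(1)}, …, z_{σ(m)})`. -/
instance (P : EllipticParams) (n m : ℕ) :
    MulSemiringAction (Equiv.Perm (Fin m)) (OpFun P n m) where
  smul σ F := fun z => permOp P n σ * F (z ∘ σ) * permOp P n σ⁻¹
  one_smul F := by
    funext z
    change permOp P n 1 * F (z ∘ _) * permOp P n (1 : Equiv.Perm (Fin m))⁻¹ = F z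
    rw [inv_one, permOp_one, one_mul, mul_one]
    rfl
  mul_smul σ τ F := by
    funext z
    change permOp P n (σ * τ) * F (z ∘ ⇑(σ * τ)) * permOp P n (σ * τ)⁻¹ =
      permOp P n σ * (permOp P n τ * F ((z ∘ σ) ∘ τ) * permOp P n τ⁻¹) * permOp P n σ⁻¹
    rw [mul_inv_rev, permOp_mul, permOp_mul]
    simp only [mul_assoc]
    rfl
  smul_zero σ := by
    funext z
    change permOp P n σ * 0 * permOp P n σ⁻¹ = 0
    simp
  smul_add σ F G := by
    funext z
    change permOp P n σ * (F (z ∘ σ) + G (z ∘ σ)) * permOp P n σ⁻¹ =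
      permOp P n σ * F (z ∘ σ) * permOp P n σ⁻¹ + permOp P n σ * G (z ∘ σ) * permOp P n σ⁻¹
    rw [mul_add, add_mul]
  smul_one σ := by
    funext z
    change permOp P n σ * 1 * permOp P n σ⁻¹ = 1
    rw [mul_one, ← permOp_mul, mul_inv_cancel, permOp_one]
  smul_mul σ F G := by
    funext z
    change permOp P n σ * (F (z ∘ σ) * G (z ∘ σ)) * permOp P n σ⁻¹ =
      (permOp P n σ * F (z ∘ σ) * permOp P n σ⁻¹) * (permOp P n σ * G (z ∘ σ) * permOp P n σ⁻¹)
    have h : permOp P n σ⁻¹ * permOp P n σ = 1 := by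
      rw [← permOp_mul, inv_mul_cancel, permOp_one]
    simp only [mul_assoc]
    rw [← mul_assoc (permOp P n σ⁻¹) (permOp P n σ), h, one_mul]

/-- The skew group algebra, with product `(F ⊗ σ)(G ⊗ τ) = F σ(G) ⊗ σ τ`; the element `F ⊗ σ` is
`SkewMonoidAlgebra.single σ F`. -/
abbrev SkewAlg (P : EllipticParams) (n m : ℕ) : Type :=
  SkewMonoidAlgebra (OpFun P n m) (Equiv.Perm (Fin m))

/-! ## The positive braid monoid and the operators `C_b`

The generator `s_{i+1}` and the tensor factors `i + 1`, `i + 2` (counted from one) have the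
zero-based labels `i` and `i`, `i + 1`. -/

/-- The braid relations on `m` strands. -/
inductive BraidRel (m : ℕ) : FreeMonoid (Fin (m - 1)) → FreeMonoid (Fin (m - 1)) → Prop
  | braid (i j : Fin (m - 1)) (h : (i : ℕ) + 1 = j) :
      BraidRel m (FreeMonoid.of i * FreeMonoid.of j * FreeMonoid.of i)
        (FreeMonoid.of j * FreeMonoid.of i * FreeMonoid.of j)
  | far (i j : Fin (m - 1)) (h : (i : ℕ) + 1 < j ∨ (j : ℕ) + 1 < i) :
      BraidRel m (FreeMonoid.of i * FreeMonoid.of j) (FreeMonoid.of j * FreeMonoid.of i)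

/-- The positive braid monoid on `m` strands. -/
abbrev BraidMonoid (m : ℕ) : Type := PresentedMonoid (BraidRel m)

/-- The first of the two tensor factors exchanged by a generator. -/
def legFst {m : ℕ} (i : Fin (m - 1)) : Fin m := ⟨i, by omega⟩

/-- The second of the two tensor factors exchanged by a generator. -/
def legSnd {m : ℕ} (i : Fin (m - 1)) : Fin m := ⟨i + 1, by omega⟩

/-- The transposition `σ_i` of neighbours. -/
def sigma {m : ℕ} (i : Fin (m - 1)) : Equiv.Perm (Fin m) := Equiv.swap (legFst i) (legSnd i)

/-- `π`, the permutation of a braid word. -/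
def permWord {m : ℕ} (w : FreeMonoid (Fin (m - 1))) : Equiv.Perm (Fin m) :=
  FreeMonoid.lift sigma w

/-- The coefficients of `h^{≥ k} = ∑_{j ≥ k} h^j`, for a zero-based position `k`. -/
def hGe {m : ℕ} (k : ℕ) : Fin m → ℤ := fun j => if k ≤ (j : ℕ) then 1 else 0

/-- `C_{s_i}(ζ, z)`: the operator `R^{i,i+1}(ζ - h^{≥ i+2}, z_i / z_{i+1})`, with the regularized
R-matrix. -/
def cherGen (P : EllipticParams) {n m : ℕ} (i : Fin (m - 1)) (z : Fin m → ℂˣ) : DynOp n m :=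
  shift (-hGe (i + 2)) (legR P (legFst i) (legSnd i) (z (legFst i) / z (legSnd i)))

/-- Conjugation of an operator on `V^{⊗ m}` by a permutation of the tensor factors. -/
def permDyn {n m : ℕ} (σ : Equiv.Perm (Fin m)) (A : DynOp n m) : DynOp n m :=
  fun b a => A (b ∘ σ) (a ∘ σ)

/-- `C_w(ζ, z)` for a braid word `w`: `C_1 = 1` and `C_{s_i w} = C_{s_i} · σ_i(C_w)`, where
`σ(F(z)) = σ ∘ F(σ(z)) ∘ σ⁻¹`. -/
def cherWord (P : EllipticParams) {n m : ℕ} :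
    List (Fin (m - 1)) → (Fin m → ℂˣ) → DynOp n m
  | [], _ => 1
  | i :: w, z => cherGen P i z * permDyn (sigma i) (cherWord P w (z ∘ sigma i))

/-- The word of `t_d`: `t_1 = 1` and `t_d = t_{d-1} s_{d-1} s_{d-2} ⋯ s_1`. -/
def tWord (m : ℕ) : (d : ℕ) → d ≤ m → List (Fin (m - 1))
  | 0, _ => []
  | d + 1, h => tWord m d (Nat.le_of_succ_le h) ++
      ((List.finRange d).map (Fin.castLE (Nat.le_sub_one_of_lt h))).reverse

end EllipticRLL

end

open EllipticRLL

/-!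
The whole theorem rests on Weierstrass's three-term identity for theta functions. The holomorphic
functions on the punctured plane with `f (p z) = z⁻² f z` are determined by two of their Laurent
coefficients (`eq_zero_of_quasiperiodic`), so that any three of the functions `x ↦ θ(x y) θ(x / y)`
are linearly dependent (`exists_thetaPair_dependent`). Hence the alternating function
`x⁻¹ θ(x y) θ(x / y)` has rank at most two, and its Pfaffians of size four vanish; this is the
three-term identity (`thetaPair_plucker`, `theta_three_term`).

The R-matrix preserves the weight, so that the dynamical Yang–Baxter equation splits into
identities between Boltzmann weights, one for each pair of arrangements of three labels, and all of
these follow from one or two three-term identities. As meromorphic functions are classes of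
functions that agree at generic points, it suffices to check the identities where the denominators
do not vanish. This gives `dynamical_yangBaxter`. Since every operator in question preserves the
weights by which it is shifted, dynamical shifts are multiplicative, and the Yang–Baxter equation
becomes the braid relation for the `C_{s_i}`; the relation for distant generators is clear, and the
action `W` of the braid monoid is obtained from its presentation (`exists_braid_hom`).

For the exchange relations, let `Λ_d` be the product `L^d(z_d) ⋯ L^1(z_1)`. For a generator `s_i`
with both legs among the first `d`, the relation
`C_{s_i}(λ + h^{≥ d}) σ_i(Λ_d) = Λ_d C_{s_i}(ρ + h^{≤ m})` (where `h^{≥ d}` uses zero-based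
positions) is the RLL relation of the two legs `i`, `i + 1` once the R-matrix has been moved past
the other factors: moving it through `L^k(z_k)` changes the dynamical shift by the weight of the
factor `k`, and these changes match the shifts in the definition of `C_{s_i}`
(`shiftedCherOp_singleton_mul_LopList`). The cocycle rule `C_{s_i w} = C_{s_i} σ_i(C_w)` extends it
to `C_w(λ + h^{≥ d}) π(w)(Λ_d) = Λ_d C_w(ρ + h^{≤ m})` for every word `w` on the first `d` strands
(`shiftedCherOp_mul_LopList`). Finally `π(t_d)` reverses the first `d` legs (`map_tWord_descLegs`),
so that `π(t_d)(Λ_d)` is `L^1(z_1) ⋯ L^d(z_d)`.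
-/

noncomputable section

namespace EllipticRLL

/-! ### Theta functions -/

lemma halfTheta_eq_mul (P : EllipticParams) (z : ℂ) :
    halfTheta P z = (1 - z) * halfTheta P (P.p * z) := by
  have hm := multipliable_one_add_of_summable (summable_norm_half P (P.p * z))
  unfold halfTheta
  rw [tprod_eq_zero_mul']
  · congr 1
    · ring
    · congr 1
      funext j
      ring
  · refine hm.congr fun j => ?_
    ring

lemma theta_inv (P : EllipticParams) {z : ℂ} (hz : z ≠ 0) : theta P z⁻¹ = -(theta P z / z) := by
  rw [theta_eq, theta_eq, halfTheta_eq_mul P z⁻¹, halfTheta_eq_mul P z, div_inv_eq_mul,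
    ← div_eq_mul_inv]
  field_simp
  ring

lemma theta_p_mul (P : EllipticParams) {z : ℂ} (hz : z ≠ 0) :
    theta P (P.p * z) = -(theta P z / z) := by
  have hp : (P.p : ℂ) ≠ 0 := by exact_mod_cast P.p_pos.ne'
  rw [← theta_inv P hz, theta_eq, theta_eq, div_inv_eq_mul, mul_comm (halfTheta P z⁻¹),
    div_mul_cancel_left₀ hp]

/-- The Laurent coefficients of a holomorphic function on the punctured plane do not depend on
the radius of the circle of integration. -/
lemma circleIntegral_zpow_mul_eq {f : ℂ → ℂ} (hf : ∀ z ≠ 0, DifferentiableAt ℂ f z) (k : ℤ)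
    {r R : ℝ} (hr : 0 < r) (hrR : r ≤ R) :
    (∮ z in C(0, R), z ^ k * f z) = ∮ z in C(0, r), z ^ k * f z := by
  have hd : ∀ z : ℂ, z ≠ 0 → DifferentiableAt ℂ (fun z => z ^ k * f z) z := fun z hz =>
    (differentiableAt_zpow.2 (Or.inl hz)).mul (hf z hz)
  refine Complex.circleIntegral_eq_of_differentiable_on_annulus_off_countable hr hrR
    Set.countable_empty ?_ ?_
  · intro z hz
    refine (hd z ?_).continuousAt.continuousWithinAt
    rintro rfl
    exact hz.2 (Metric.mem_ball_self hr)
  · intro z hz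
    refine hd z ?_
    rintro rfl
    exact hz.1.2 (Metric.mem_closedBall_self hr.le)

/-- A holomorphic function on the punctured plane whose Laurent coefficients all vanish is zero. -/
lemma eq_zero_of_circleIntegral_eq_zero {f : ℂ → ℂ} (hf : ∀ z ≠ 0, DifferentiableAt ℂ f z)
    (h : ∀ k : ℤ, (∮ z in C(0, 1), z ^ k * f z) = 0) {z : ℂ} (hz : z ≠ 0) : f z = 0 := by
  have : Fact (0 < 2 * Real.pi) := ⟨Real.two_pi_pos⟩
  have hcont : Continuous fun t : AddCircle (2 * Real.pi) => f (t.toCircle : ℂ) := by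
    refine continuous_iff_continuousAt.2 fun t => ?_
    exact ContinuousAt.comp' (f := fun t : AddCircle (2 * Real.pi) => (t.toCircle : ℂ))
      (hf _ (Circle.coe_ne_zero _)).continuousAt
      (continuous_subtype_val.comp AddCircle.continuous_toCircle).continuousAt
  let g : C(AddCircle (2 * Real.pi), ℂ) := ⟨_, hcont⟩
  have hcoef : fourierCoeff g = 0 := by
    funext k
    rw [fourierCoeff_eq_intervalIntegral g k 0]
    have hk := h (-k - 1)
    simp only [circleIntegral, deriv_circleMap, smul_eq_mul] at hk
    have hne : ∀ t : ℝ, circleMap 0 1 t ≠ 0 := fun t => circleMap_ne_center one_ne_zero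
    have : ∀ t : ℝ, circleMap 0 1 t * Complex.I * (circleMap 0 1 t ^ (-k - 1) *
        f (circleMap 0 1 t)) = Complex.I * (fourier (-k) (t : AddCircle (2 * Real.pi)) • g t) := by
      intro t
      have hc : (AddCircle.toCircle (t : AddCircle (2 * Real.pi)) : ℂ) = circleMap 0 1 t := by
        rw [AddCircle.toCircle_apply_mk]
        simp [circleMap]
      change _ = Complex.I * (fourier (-k) (t : AddCircle (2 * Real.pi)) •
        f (AddCircle.toCircle (t : AddCircle (2 * Real.pi)) : ℂ))
      rw [fourier_apply, AddCircle.toCircle_zsmul, Circle.coe_zpow, hc, zpow_sub_one₀ (hne t),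
        smul_eq_mul]
      field_simp [hne t]
    simp only [this] at hk
    rw [intervalIntegral.integral_const_mul] at hk
    rw [zero_add, (mul_eq_zero.1 hk).resolve_left Complex.I_ne_zero, smul_zero]
    rfl
  have hzero : ∀ t : AddCircle (2 * Real.pi), f (t.toCircle : ℂ) = 0 := by
    intro t
    have hs := has_pointwise_sum_fourier_series_of_summable (f := g)
      (by rw [hcoef]; exact summable_zero) t
    rw [hcoef] at hs
    simp only [Pi.zero_apply, zero_smul] at hs
    exact hs.unique hasSum_zero
  have hU : IsPreconnected ({0}ᶜ : Set ℂ) :=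
    (isConnected_compl_singleton_of_one_lt_rank (by simp) (0 : ℂ)).isPreconnected
  have han : AnalyticOnNhd ℂ f ({0}ᶜ : Set ℂ) :=
    DifferentiableOn.analyticOnNhd (fun w hw => (hf w hw).differentiableWithinAt)
      isOpen_compl_singleton
  refine han.eqOn_zero_of_preconnected_of_frequently_eq_zero hU (z₀ := 1) (by simp) ?_ hz
  -- The identity theorem applies, as `1` is an accumulation point of the unit circle.
  have ht : Tendsto (fun t : ℝ => Complex.exp (t * Complex.I)) (𝓝[>] 0) (𝓝[≠] 1) := by
    refine tendsto_nhdsWithin_iff.2 ⟨?_, ?_⟩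
    · have : Continuous fun t : ℝ => Complex.exp (t * Complex.I) := by fun_prop
      simpa using (this.tendsto 0).mono_left nhdsWithin_le_nhds
    · filter_upwards [Ioo_mem_nhdsGT Real.two_pi_pos] with t ht h1
      obtain ⟨m, hm⟩ := Complex.exp_eq_one_iff.1 h1
      have hm' : t = m * (2 * Real.pi) := by
        have := congrArg Complex.im hm
        simpa using this
      have h2 : (0 : ℝ) < m := by
        by_contra hc
        nlinarith [ht.1, Real.pi_pos]
      have h3 : (m : ℝ) < 1 := by
        by_contra hc
        nlinarith [ht.2, Real.pi_pos]
      norm_cast at h2 h3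
      omega
  refine ht.frequently (Eventually.frequently (Eventually.of_forall fun t => ?_))
  have := hzero (t : AddCircle (2 * Real.pi))
  rw [AddCircle.toCircle_apply_mk] at this
  simpa using this

/-- The holomorphic functions on the punctured plane with `f (p z) = z⁻² f z` are determined by
two of their Laurent coefficients. -/
lemma eq_zero_of_quasiperiodic (P : EllipticParams) {f : ℂ → ℂ}
    (hf : ∀ z ≠ 0, DifferentiableAt ℂ f z) (hp : ∀ z ≠ 0, f (P.p * z) = f z / z ^ 2)
    (h0 : (∮ z in C(0, 1), z ^ (-1 : ℤ) * f z) = 0)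
    (h1 : (∮ z in C(0, 1), z ^ (-2 : ℤ) * f z) = 0) {z : ℂ} (hz : z ≠ 0) : f z = 0 := by
  have hpc : (P.p : ℂ) ≠ 0 := by exact_mod_cast P.p_pos.ne'
  -- The substitution `z ↦ p z` relates the Laurent coefficients in degrees differing by two.
  have step : ∀ k : ℤ, (P.p : ℂ) ^ (-(k + 1)) * (∮ z in C(0, 1), z ^ k * f z) =
      ∮ z in C(0, 1), z ^ (k - 2) * f z := by
    intro k
    rw [circleIntegral_zpow_mul_eq hf k P.p_pos P.p_lt_one.le]
    simp only [circleIntegral, deriv_circleMap, smul_eq_mul, ← intervalIntegral.integral_const_mul]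
    refine intervalIntegral.integral_congr fun t _ => ?_
    have hc : circleMap 0 P.p t = P.p * circleMap 0 1 t := by simp [circleMap]
    have hne : circleMap 0 1 t ≠ 0 := circleMap_ne_center one_ne_zero
    simp only [hc, hp _ hne]
    rw [mul_zpow, zpow_neg, zpow_add_one₀ hpc, zpow_sub₀ hne]
    field_simp
  have hall : ∀ k : ℤ, (∮ z in C(0, 1), z ^ k * f z) = 0 ∧
      (∮ z in C(0, 1), z ^ (k - 1) * f z) = 0 := by
    intro k
    induction k using Int.induction_on with
    | zero =>
      have := step 0
      rw [show (0 : ℤ) - 2 = -2 by norm_num, h1] at this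
      exact ⟨(mul_eq_zero.1 this).resolve_left (zpow_ne_zero _ hpc), h0⟩
    | succ k ih =>
      have := step (k + 1)
      rw [show (k : ℤ) + 1 - 2 = k - 1 by ring, ih.2] at this
      exact ⟨(mul_eq_zero.1 this).resolve_left (zpow_ne_zero _ hpc), by
        rw [add_sub_cancel_right]; exact ih.1⟩
    | pred k ih =>
      have := step (-k)
      rw [ih.1, mul_zero] at this
      refine ⟨ih.2, ?_⟩
      rw [show -(k : ℤ) - 1 - 1 = -k - 2 by ring]
      exact this.symm
  exact eq_zero_of_circleIntegral_eq_zero hf (fun k => (hall k).1) hz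

/-- `x⁻¹ θ(x y) θ(x / y)`, an alternating function of `x`, `y` of rank two. -/
def thetaPair (P : EllipticParams) (x y : ℂ) : ℂ := theta P (x * y) * theta P (x / y) / x

lemma thetaPair_swap (P : EllipticParams) {x y : ℂ} (hx : x ≠ 0) (hy : y ≠ 0) :
    thetaPair P x y = -thetaPair P y x := by
  have h := theta_inv P (div_ne_zero hx hy)
  rw [inv_div] at h
  unfold thetaPair
  rw [h, mul_comm y x]
  field_simp

lemma thetaPair_self (P : EllipticParams) {x : ℂ} (hx : x ≠ 0) : thetaPair P x x = 0 :=
  self_eq_neg.1 (thetaPair_swap P hx hx)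

/-- Any three of the functions `x ↦ θ(x y) θ(x / y)` are linearly dependent, as they lie in a space
of dimension at most two. -/
lemma exists_thetaPair_dependent (P : EllipticParams) {y : Fin 3 → ℂ} (hy : ∀ i, y i ≠ 0) :
    ∃ c : Fin 3 → ℂ, c ≠ 0 ∧ ∀ x ≠ 0, ∑ i, c i * thetaPair P x (y i) = 0 := by
  let F : Fin 3 → ℂ → ℂ := fun i x => theta P (x * y i) * theta P (x / y i)
  have hF : ∀ i, ∀ x ≠ 0, DifferentiableAt ℂ (F i) x := fun i x hx => by
    have h1 : DifferentiableAt ℂ (theta P) (x * y i) :=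
      (analyticAt_theta P (mul_ne_zero hx (hy i))).differentiableAt
    have h2 : DifferentiableAt ℂ (theta P) (x / y i) :=
      (analyticAt_theta P (div_ne_zero hx (hy i))).differentiableAt
    have e1 := h1.fun_comp' x (by fun_prop : DifferentiableAt ℂ (fun x => x * y i) x)
    have e2 := h2.fun_comp' x (by fun_prop : DifferentiableAt ℂ (fun x => x / y i) x)
    exact e1.mul e2
  have hFp : ∀ i, ∀ x ≠ 0, F i (P.p * x) = F i x / x ^ 2 := fun i x hx => by
    have := hy i
    simp only [F]
    rw [mul_assoc, mul_div_assoc, theta_p_mul P (mul_ne_zero hx (hy i)),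
      theta_p_mul P (div_ne_zero hx (hy i))]
    field_simp
  let a : ℤ → Fin 3 → ℂ := fun k i => ∮ z in C(0, 1), z ^ k * F i z
  let M : Matrix (Fin 2) (Fin 3) ℂ := Matrix.of ![a (-1), a (-2)]
  obtain ⟨c, hc, hMc⟩ : ∃ c : Fin 3 → ℂ, c ≠ 0 ∧ M.mulVec c = 0 := by
    obtain ⟨c, hc, hc0⟩ := (Submodule.ne_bot_iff _).1
      (LinearMap.ker_ne_bot_of_finrank_lt (f := M.mulVecLin) (by simp))
    exact ⟨c, hc0, hc⟩
  refine ⟨c, hc, fun x hx => ?_⟩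
  have hint : ∀ k : ℤ, (∮ z in C(0, 1), z ^ k * ∑ i, c i * F i z) = ∑ i, a k i * c i := by
    intro k
    have hi : ∀ i ∈ Finset.univ, CircleIntegrable (fun z => c i * (z ^ k * F i z)) 0 1 := by
      intro i _
      refine ContinuousOn.circleIntegrable zero_le_one fun z hz => ?_
      have hz0 : z ≠ 0 := by
        rintro rfl
        simp at hz
      exact (((differentiableAt_zpow.2 (Or.inl hz0)).mul (hF i z hz0)).const_mul
        (c i)).continuousAt.continuousWithinAt
    have : ∀ z : ℂ, z ^ k * ∑ i, c i * F i z = ∑ i, c i * (z ^ k * F i z) := by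
      intro z
      rw [Finset.mul_sum]
      exact Finset.sum_congr rfl fun i _ => by ring
    simp only [this]
    rw [circleIntegral.integral_fun_sum hi]
    exact Finset.sum_congr rfl fun i _ => by
      rw [circleIntegral.integral_const_mul, mul_comm]
  have key := eq_zero_of_quasiperiodic P (f := fun x => ∑ i, c i * F i x)
    (fun z hz => DifferentiableAt.fun_sum fun i _ => (hF i z hz).const_mul (c i))
    (fun z hz => by
      rw [Finset.sum_div]
      exact Finset.sum_congr rfl fun i _ => by rw [hFp i z hz, ← mul_div_assoc])
    (by rw [hint]; exact congrFun hMc 0) (by rw [hint]; exact congrFun hMc 1) hx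
  have : ∑ i, c i * thetaPair P x (y i) = (∑ i, c i * F i x) / x := by
    rw [Finset.sum_div]
    exact Finset.sum_congr rfl fun i _ => by rw [thetaPair, ← mul_div_assoc]
  rw [this, key, zero_div]

/-- **Weierstrass's three-term identity**, as the vanishing of the Pfaffian of an alternating
matrix of rank at most two. -/
lemma thetaPair_plucker (P : EllipticParams) {x y u v : ℂ} (hx : x ≠ 0) (hy : y ≠ 0) (hu : u ≠ 0)
    (hv : v ≠ 0) :
    thetaPair P x y * thetaPair P u v - thetaPair P x u * thetaPair P y v +
      thetaPair P x v * thetaPair P y u = 0 := by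
  obtain ⟨c, hc, h⟩ := exists_thetaPair_dependent P (y := ![y, u, v]) (by
    intro i
    fin_cases i <;> simpa)
  simp only [Fin.sum_univ_three, Matrix.cons_val] at h
  have e0 := h x hx
  have e1 := h y hy
  have e2 := h u hu
  have e3 := h v hv
  rw [thetaPair_self P hy] at e1
  rw [thetaPair_self P hu, thetaPair_swap P hu hy] at e2
  rw [thetaPair_self P hv, thetaPair_swap P hv hy, thetaPair_swap P hv hu] at e3
  -- `e0, …, e3` say that `c` is a nonzero kernel vector of the alternating matrix of the four
  -- points, and `c i` times the Pfaffian is a combination of its entries.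
  obtain ⟨i, hi⟩ := Function.ne_iff.1 hc
  refine (mul_eq_zero.1 ?_).resolve_left hi
  fin_cases i
  · simp only [Fin.zero_eta]
    linear_combination thetaPair P u v * e0 + thetaPair P x u * e3 - thetaPair P x v * e2
  · simp only [Fin.mk_one]
    linear_combination -thetaPair P y v * e0 + thetaPair P x v * e1 - thetaPair P x y * e3
  · simp only [Fin.reduceFinMk]
    linear_combination thetaPair P y u * e0 - thetaPair P x u * e1 + thetaPair P x y * e2

/-- Weierstrass's three-term identity in multiplicative parameters without square roots. -/
lemma theta_three_term (P : EllipticParams) {u v X Y : ℂ} (hu : u ≠ 0) (hv : v ≠ 0) (hX : X ≠ 0)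
    (hY : Y ≠ 0) :
    X * theta P u * theta P v * theta P (X * Y * u * v) * theta P (Y / X) =
      theta P (X * u) * theta P (X * v) * theta P (Y * u * v) * theta P Y -
        theta P (Y * v) * theta P (Y * u) * theta P (X * u * v) * theta P X := by
  -- The four points are `Y w`, `w`, `X w` and `u / w`.
  obtain ⟨w, hw⟩ := IsAlgClosed.exists_pow_nat_eq (u * v) (n := 2) two_pos
  have hw0 : w ≠ 0 := by
    rintro rfl
    simp [hu, hv] at hw
  have h := thetaPair_plucker P (mul_ne_zero hY hw0) hw0 (mul_ne_zero hX hw0) (div_ne_zero hu hw0)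
  have r1 : Y * w * w = Y * u * v := by linear_combination Y * hw
  have r2 : X * w * w = X * u * v := by linear_combination X * hw
  have r2' : w * (X * w) = X * u * v := by linear_combination X * hw
  have r3 : X * w / (u / w) = X * v := by field_simp; linear_combination hw
  have r4 : Y * w / (u / w) = Y * v := by field_simp; linear_combination hw
  have r5 : Y * w * (X * w) = X * Y * u * v := by linear_combination X * Y * hw
  have r6 : w / (u / w) = v := by field_simp; linear_combination hw
  have r7 : w * (u / w) = u := by field_simp
  have r8 : X * w * (u / w) = X * u := by field_simp
  have r9 : Y * w * (u / w) = Y * u := by field_simp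
  have r10 : Y * w / w = Y := by field_simp
  have r11 : X * w / w = X := by field_simp
  have r12 : Y * w / (X * w) = Y / X := by field_simp
  rw [thetaPair_swap P hw0 (mul_ne_zero hX hw0)] at h
  unfold thetaPair at h
  rw [r1, r2, r3, r4, r5, r6, r7, r8, r9, r10, r11, r12] at h
  generalize theta P (X * u) = a, theta P (X * v) = b, theta P (X * u * v) = c,
    theta P (Y * u) = d, theta P (Y * v) = e, theta P (Y * u * v) = f,
    theta P (X * Y * u * v) = g at h ⊢
  field_simp at h
  linear_combination -h

/-! ### Dynamical Boltzmann weights -/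

/-- The diagonal weight `θ(z) θ(t X) / θ(X)` of the regularized R-matrix, where `t = q ^ 2` and
`X = q ^ (2 ζ_ab)`. -/
def diagWeight (P : EllipticParams) (t X z : ℂ) : ℂ := theta P z * theta P (t * X) / theta P X

/-- The exchange weight `θ(t) θ(X z) / θ(X)` of the regularized R-matrix, where `t = q ^ 2` and
`X = q ^ (2 ζ_ab)`. -/
def swapWeight (P : EllipticParams) (t X z : ℂ) : ℂ := theta P t * theta P (X * z) / theta P X

section Weights

variable (P : EllipticParams) {t u v X Y W : ℂ}

lemma theta_inv_mul {x y : ℂ} (hx : x ≠ 0) (hy : y ≠ 0) :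
    theta P (x * y⁻¹) = -(x / y * theta P (y / x)) := by
  have h := theta_inv P (div_ne_zero hy hx)
  rw [inv_div] at h
  rw [← div_eq_mul_inv, h]
  field_simp

lemma diagWeight_inv (ht : t ≠ 0) (hX : X ≠ 0) (z : ℂ) :
    diagWeight P t X⁻¹ z = t * theta P z * theta P (X / t) / theta P X := by
  rw [diagWeight, theta_inv P hX, theta_inv_mul P ht hX, div_neg, mul_neg, neg_div, neg_neg,
    div_div_eq_mul_div]
  congr 1
  field_simp

lemma swapWeight_inv (hX : X ≠ 0) (z : ℂ) :
    swapWeight P t X⁻¹ z = -(X * theta P t * theta P (z / X) / theta P X) := by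
  rw [swapWeight, theta_inv P hX, div_neg, div_div_eq_mul_div, mul_comm X⁻¹ z, ← div_eq_mul_inv]
  congr 2
  ring

/-- The three-term identity with `v`, `t`, `W`, `u` in place of `u`, `v`, `X`, `Y`. -/
lemma theta_three_term' (ht : t ≠ 0) (hu : u ≠ 0) (hv : v ≠ 0) (hW : W ≠ 0) :
    theta P (W * v) * theta P (t * u * v) * theta P u * theta P (t * W) -
      W * theta P v * theta P t * theta P (t * W * u * v) * theta P (u / W) =
    theta P (t * u) * theta P (u * v) * theta P (t * W * v) * theta P W := by
  have h := theta_three_term P hv ht hW hu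
  rw [show W * u * v * t = t * W * u * v by ring, show u * v * t = t * u * v by ring,
    show W * v * t = t * W * v by ring, mul_comm W t, mul_comm u t] at h
  linear_combination -h

/-- The three-term identity with `u`, `W`, `t`, `v / W` in place of `u`, `v`, `X`, `Y`. -/
lemma theta_three_term'' (ht : t ≠ 0) (hu : u ≠ 0) (hv : v ≠ 0) (hW : W ≠ 0) :
    theta P (v / W) * theta P (u * v) * theta P (t * u) * theta P (t * W) =
      t * theta P u * theta P (t * u * v) * theta P (v / (t * W)) * theta P W +
        theta P t * theta P (t * W * u) * theta P (u * v / W) * theta P v := by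
  have h := theta_three_term P hu hW ht (div_ne_zero hv hW)
  rw [show t * (v / W) * u * W = t * u * v by field_simp,
    show v / W * u * W = u * v by field_simp, show t * u * W = t * W * u by ring,
    show v / W * W = v by field_simp, show v / W * u = u * v / W by ring,
    show v / W / t = v / (t * W) by field_simp] at h
  linear_combination -h

/-! The weights satisfy the dynamical Yang–Baxter equation.  Here `u`, `v` are the spectral
parameters.  For three distinct labels `a`, `b`, `c` one has `X = q ^ (2 ζ_ab)` and
`Y = q ^ (2 ζ_bc)`; for two labels `a`, `b`, one of them occurring twice, `t W = q ^ (2 ζ_ab)`,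
so that `W` is the value at `ζ - ω(a)`.  The suffix of a name gives the column and the row of the
matrix element: `abc_bca` is the coefficient of `e_b ⊗ e_c ⊗ e_a` in the image of
`e_a ⊗ e_b ⊗ e_c`. -/

lemma weights_abc_bca (hu : u ≠ 0) (hv : v ≠ 0) (hX : X ≠ 0) (hY : Y ≠ 0)
    (hX' : theta P X ≠ 0) (hY' : theta P Y ≠ 0) (hXY : theta P (X * Y) ≠ 0) :
    swapWeight P t Y v * swapWeight P t X (u * v) * diagWeight P t Y u +
      diagWeight P t Y v * swapWeight P t (X * Y) (u * v) * swapWeight P t Y⁻¹ u =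
    swapWeight P t X u * diagWeight P t Y (u * v) * swapWeight P t (X * Y) v := by
  rw [swapWeight_inv P hY]
  have h := theta_three_term' P hX hu hv hY
  unfold swapWeight diagWeight
  rw [← mul_assoc X u v, ← mul_assoc (X * Y) u v]
  generalize theta P t = τ at *
  generalize theta P (t * Y) = κ at *
  iterate 12 generalize theta P _ = a at *
  field_simp
  linear_combination τ ^ 2 * κ * h

lemma weights_abc_cab (hu : u ≠ 0) (hv : v ≠ 0) (hX : X ≠ 0) (hY : Y ≠ 0)
    (hX' : theta P X ≠ 0) (hY' : theta P Y ≠ 0) (hXY : theta P (X * Y) ≠ 0) :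
    swapWeight P t Y v * diagWeight P t X (u * v) * swapWeight P t (X * Y) u =
    swapWeight P t X u * swapWeight P t Y (u * v) * diagWeight P t X v +
      diagWeight P t X u * swapWeight P t (X * Y) (u * v) * swapWeight P t X⁻¹ v := by
  rw [swapWeight_inv P hX]
  have h := theta_three_term' P hY hv hu hX
  rw [show Y * v * u = Y * (u * v) by ring, show Y * X * v * u = X * Y * (u * v) by ring,
    mul_comm v u, mul_comm Y X] at h
  unfold swapWeight diagWeight
  generalize theta P t = τ at *
  generalize theta P (t * X) = κ at *
  iterate 11 generalize theta P _ = a at *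
  field_simp
  linear_combination -(τ ^ 2 * κ * h)

lemma weights_abc_cba (ht : t ≠ 0) (hu : u ≠ 0) (hv : v ≠ 0) (hX : X ≠ 0) (hY : Y ≠ 0)
    (hX' : theta P X ≠ 0) (hY' : theta P Y ≠ 0) (hXY : theta P (X * Y) ≠ 0) :
    diagWeight P t Y v * swapWeight P t (X * Y) (u * v) * diagWeight P t Y⁻¹ u +
      swapWeight P t Y v * swapWeight P t X (u * v) * swapWeight P t Y u =
    diagWeight P t X u * swapWeight P t (X * Y) (u * v) * diagWeight P t X⁻¹ v +
      swapWeight P t X u * swapWeight P t Y (u * v) * swapWeight P t X v := by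
  rw [diagWeight_inv P ht hX, diagWeight_inv P ht hY]
  -- `h1` is free of the spectral parameters and computes the difference of the products of
  -- diagonal weights; `h2` computes the difference of the products of exchange weights.
  have h1 := theta_three_term P (inv_ne_zero ht) (inv_ne_zero ht) (mul_ne_zero ht hX)
    (mul_ne_zero ht hY)
  rw [theta_inv P ht, show t * X * (t * Y) * t⁻¹ * t⁻¹ = X * Y by field_simp,
    show t * Y / (t * X) = Y / X by field_simp, show t * X * t⁻¹ = X by field_simp,
    show t * Y * t⁻¹ = Y by field_simp, ← div_eq_mul_inv, ← div_eq_mul_inv] at h1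
  have h2 := theta_three_term P hu hv hX hY
  unfold swapWeight diagWeight
  rw [← mul_assoc X u v, ← mul_assoc (X * Y) u v, ← mul_assoc Y u v]
  have h1' : t * (theta P X ^ 2 * theta P (Y / t) * theta P (t * Y) -
      theta P Y ^ 2 * theta P (X / t) * theta P (t * X)) =
      X * theta P t ^ 2 * theta P (X * Y) * theta P (Y / X) := by
    iterate 9 generalize theta P _ = a at h1 ⊢
    field_simp at h1
    linear_combination -h1
  generalize theta P t = τ at *
  generalize theta P u = α at *
  generalize theta P v = β at *
  generalize theta P (X * Y * u * v) = γ at *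
  generalize theta P (X * Y) = κ at *
  iterate 12 generalize theta P _ = a at *
  field_simp
  linear_combination τ * α * β * γ * h1' + τ ^ 3 * κ * h2

lemma weights_aab_baa (ht : t ≠ 0) (hu : u ≠ 0) (hv : v ≠ 0) (hW : W ≠ 0)
    (hW' : theta P W ≠ 0) (htW : theta P (t * W) ≠ 0) :
    diagWeight P t W v * swapWeight P t (t * W) (u * v) * diagWeight P t W⁻¹ u +
      swapWeight P t W v * theta P (t * (u * v)) * swapWeight P t W u =
    theta P (t * u) * swapWeight P t W (u * v) * theta P (t * v) := by
  rw [diagWeight_inv P ht hW]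
  have h := theta_three_term P hu hv ht hW
  unfold swapWeight diagWeight
  rw [← mul_assoc (t * W) u v, ← mul_assoc W u v, ← mul_assoc t u v]
  generalize theta P t = τ at *
  iterate 11 generalize theta P _ = a at *
  field_simp
  linear_combination τ * h

lemma weights_aab_aba (ht : t ≠ 0) (hu : u ≠ 0) (hv : v ≠ 0) (hW : W ≠ 0)
    (hW' : theta P W ≠ 0) (htW : theta P (t * W) ≠ 0) :
    swapWeight P t W v * theta P (t * (u * v)) * diagWeight P t W u +
      diagWeight P t W v * swapWeight P t (t * W) (u * v) * swapWeight P t W⁻¹ u =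
    theta P (t * u) * diagWeight P t W (u * v) * swapWeight P t (t * W) v := by
  rw [swapWeight_inv P hW]
  have h := theta_three_term' P ht hu hv hW
  unfold swapWeight diagWeight
  rw [← mul_assoc (t * W) u v, ← mul_assoc t u v]
  generalize theta P t = τ at *
  iterate 11 generalize theta P _ = a at *
  field_simp
  linear_combination τ * h

lemma weights_aba_baa (ht : t ≠ 0) (hu : u ≠ 0) (hv : v ≠ 0) (hW : W ≠ 0)
    (hW' : theta P W ≠ 0) (htW : theta P (t * W) ≠ 0) :
    diagWeight P t W⁻¹ v * theta P (t * (u * v)) * swapWeight P t W u +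
      swapWeight P t W⁻¹ v * swapWeight P t (t * W) (u * v) * diagWeight P t W⁻¹ u =
    swapWeight P t (t * W) u * diagWeight P t W⁻¹ (u * v) * theta P (t * v) := by
  rw [diagWeight_inv P ht hW, diagWeight_inv P ht hW, diagWeight_inv P ht hW, swapWeight_inv P hW]
  have h := theta_three_term' P ht hv hu hW
  rw [show t * v * u = t * (u * v) by ring, show t * W * v * u = t * W * (u * v) by ring,
    mul_comm v u] at h
  unfold swapWeight
  generalize theta P t = τ at *
  generalize theta P (W / t) = κ at *
  iterate 8 generalize theta P _ = a at *
  field_simp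
  linear_combination τ * κ * h

lemma weights_aba_aab (ht : t ≠ 0) (hu : u ≠ 0) (hv : v ≠ 0) (hW : W ≠ 0)
    (hW' : theta P W ≠ 0) (htW : theta P (t * W) ≠ 0) :
    swapWeight P t W⁻¹ v * diagWeight P t (t * W) (u * v) * theta P (t * u) =
    diagWeight P t (t * W) u * theta P (t * (u * v)) * swapWeight P t (t * W)⁻¹ v +
      swapWeight P t (t * W) u * swapWeight P t W⁻¹ (u * v) * diagWeight P t (t * W) v := by
  rw [swapWeight_inv P hW, swapWeight_inv P hW, swapWeight_inv P (mul_ne_zero ht hW)]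
  have h := theta_three_term'' P ht hu hv hW
  unfold swapWeight diagWeight
  rw [← mul_assoc t u v]
  generalize theta P t = τ at *
  generalize theta P (t * (t * W)) = κ at *
  iterate 9 generalize theta P _ = a at *
  field_simp
  linear_combination -(τ * κ * h)

lemma weights_aba_aba (ht : t ≠ 0) (hu : u ≠ 0) (hv : v ≠ 0) (hW : W ≠ 0)
    (hW' : theta P W ≠ 0) (htW : theta P (t * W) ≠ 0) :
    diagWeight P t W⁻¹ v * theta P (t * (u * v)) * diagWeight P t W u +
      swapWeight P t W⁻¹ v * swapWeight P t (t * W) (u * v) * swapWeight P t W⁻¹ u =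
    diagWeight P t (t * W) u * theta P (t * (u * v)) * diagWeight P t (t * W)⁻¹ v +
      swapWeight P t (t * W) u * swapWeight P t W⁻¹ (u * v) * swapWeight P t (t * W) v := by
  have htW0 := mul_ne_zero ht hW
  rw [swapWeight_inv P hW, swapWeight_inv P hW, swapWeight_inv P hW, diagWeight_inv P ht hW,
    diagWeight_inv P ht htW0, mul_div_cancel_left₀ W ht]
  -- As for three labels, `h1` is free of the spectral parameters.
  have h1 := theta_three_term P (inv_ne_zero ht) (inv_ne_zero ht) (mul_ne_zero ht htW0) htW0
  rw [show t * (t * W) * (t * W) * t⁻¹ * t⁻¹ = t * W * W by field_simp,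
    show t * W / (t * (t * W)) = t⁻¹ by field_simp, theta_inv P ht,
    show t * (t * W) * t⁻¹ = t * W by field_simp, show t * W * t⁻¹ = W by field_simp,
    ← div_eq_mul_inv] at h1
  have h2 := theta_three_term P hu hv htW0 (inv_ne_zero hW)
  rw [show t * W * W⁻¹ * u * v = t * (u * v) by field_simp,
    show W⁻¹ / (t * W) = (t * W * W)⁻¹ by field_simp, theta_inv P hW,
    theta_inv P (mul_ne_zero htW0 hW), show W⁻¹ * u * v = u * v / W by ring,
    show W⁻¹ * u = u / W by ring, show W⁻¹ * v = v / W by ring,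
    show t * W * u * v = t * W * (u * v) by ring] at h2
  have h1' : t * (theta P (W / t) * theta P (t * W) ^ 3 -
      theta P (t * (t * W)) * theta P W ^ 3) = -(W * theta P t ^ 3 * theta P (t * W * W)) := by
    iterate 6 generalize theta P _ = a at h1 ⊢
    field_simp at h1
    linear_combination -h1
  have h2' : theta P u * theta P v * theta P (t * (u * v)) * theta P (t * W * W) =
      theta P (t * W * u) * theta P (t * W * v) * theta P (u * v / W) * theta P W +
      W * theta P (v / W) * theta P (u / W) * theta P (t * W * (u * v)) * theta P (t * W) := by
    iterate 12 generalize theta P _ = a at h2 ⊢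
    field_simp at h2
    linear_combination -h2
  unfold swapWeight diagWeight
  generalize theta P t = τ at *
  generalize theta P u = α at *
  generalize theta P v = β at *
  generalize theta P (t * (u * v)) = γ at *
  iterate 11 generalize theta P _ = a at *
  field_simp
  linear_combination α * β * γ * h1' - W * τ ^ 3 * h2'

lemma weights_baa_aba (ht : t ≠ 0) (hu : u ≠ 0) (hv : v ≠ 0) (hW : W ≠ 0)
    (hW' : theta P W ≠ 0) (htW : theta P (t * W) ≠ 0) :
    theta P (t * v) * diagWeight P t (t * W)⁻¹ (u * v) * swapWeight P t W⁻¹ u =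
    diagWeight P t (t * W)⁻¹ u * swapWeight P t W⁻¹ (u * v) * swapWeight P t (t * W) v +
      swapWeight P t (t * W)⁻¹ u * theta P (t * (u * v)) * diagWeight P t (t * W)⁻¹ v := by
  have htW0 := mul_ne_zero ht hW
  rw [swapWeight_inv P hW, swapWeight_inv P hW, swapWeight_inv P htW0,
    diagWeight_inv P ht htW0, diagWeight_inv P ht htW0, diagWeight_inv P ht htW0,
    mul_div_cancel_left₀ W ht]
  have h := theta_three_term'' P ht hv hu hW
  rw [mul_comm v u, show t * v * u = t * (u * v) by ring] at h
  unfold swapWeight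
  generalize theta P t = τ at *
  iterate 7 generalize theta P _ = a at *
  field_simp
  linear_combination -(τ * h)

lemma weights_baa_aab (ht : t ≠ 0) (hu : u ≠ 0) (hv : v ≠ 0) (hW : W ≠ 0)
    (hW' : theta P W ≠ 0) (htW : theta P (t * W) ≠ 0) :
    theta P (t * v) * swapWeight P t (t * W)⁻¹ (u * v) * theta P (t * u) =
    diagWeight P t (t * W)⁻¹ u * swapWeight P t W⁻¹ (u * v) * diagWeight P t (t * W) v +
      swapWeight P t (t * W)⁻¹ u * theta P (t * (u * v)) * swapWeight P t (t * W)⁻¹ v := by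
  have htW0 := mul_ne_zero ht hW
  rw [swapWeight_inv P hW, swapWeight_inv P htW0, swapWeight_inv P htW0, swapWeight_inv P htW0,
    diagWeight_inv P ht htW0, mul_div_cancel_left₀ W ht]
  have h := theta_three_term P hu hv ht (inv_ne_zero htW0)
  rw [show t * (t * W)⁻¹ * u * v = u * v / W by field_simp,
    show (t * W)⁻¹ / t = (t * (t * W))⁻¹ by field_simp, theta_inv P htW0,
    theta_inv P (mul_ne_zero ht htW0), show (t * W)⁻¹ * u * v = u * v / (t * W) by ring,
    show (t * W)⁻¹ * u = u / (t * W) by ring, show (t * W)⁻¹ * v = v / (t * W) by ring,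
    mul_assoc t u v] at h
  unfold diagWeight
  generalize theta P t = τ at *
  field_simp at h ⊢
  linear_combination -(τ * h)

end Weights

/-! ### Computing with representatives of meromorphic functions -/

section Represents

variable {E : Type} [NormedAddCommGroup E] [NormedSpace ℂ E]

-- Shortcuts, as instance search through the quotient is slow.
instance : CommRing (Mero E) := Ideal.Quotient.commRing _
instance : CommSemiring (Mero E) := inferInstance
instance : Ring (Mero E) := inferInstance
instance : Semiring (Mero E) := inferInstance
instance : Mul (Mero E) := inferInstance
instance : Add (Mero E) := inferInstance
instance : Zero (Mero E) := inferInstance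
instance : One (Mero E) := inferInstance
instance : AddCommMonoid (Mero E) := inferInstance
instance : NonUnitalNonAssocSemiring (Mero E) := inferInstance
instance : NonAssocSemiring (Mero E) := inferInstance
instance : NonUnitalSemiring (Mero E) := inferInstance

/-- The function `F` represents the meromorphic function `f`. -/
def Represents (F : E → ℂ) (f : Mero E) : Prop := ∃ hF : IsMero F, Mero.mk F hF = f

lemma Represents.mul {F G : E → ℂ} {f g : Mero E} (hf : Represents F f) (hg : Represents G g) :
    Represents (fun x => F x * G x) (f * g) := by
  obtain ⟨hF, rfl⟩ := hf
  obtain ⟨hG, rfl⟩ := hg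
  exact ⟨hF.mul hG, rfl⟩

lemma Represents.add {F G : E → ℂ} {f g : Mero E} (hf : Represents F f) (hg : Represents G g) :
    Represents (fun x => F x + G x) (f + g) := by
  obtain ⟨hF, rfl⟩ := hf
  obtain ⟨hG, rfl⟩ := hg
  exact ⟨hF.add hG, rfl⟩

lemma Represents.translate {F : E → ℂ} {f : Mero E} (hf : Represents F f) (α : E) :
    Represents (fun x => F (x + α)) (T α f) := by
  obtain ⟨hF, rfl⟩ := hf
  exact ⟨hF.comp_add α, rfl⟩

lemma Represents.eq {F G : E → ℂ} {f g : Mero E} (hf : Represents F f) (hg : Represents G g)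
    (h : ∀ᶠ x in residual E, F x = G x) : f = g := by
  obtain ⟨hF, rfl⟩ := hf
  obtain ⟨hG, rfl⟩ := hg
  refine Ideal.Quotient.eq.2 ?_
  change ∀ᶠ x in residual E, F x - G x = 0
  filter_upwards [h] with x hx
  rw [hx, sub_self]

lemma T_zero (f : Mero E) : T (0 : E) f = f := by
  obtain ⟨⟨F, hF⟩, rfl⟩ := Ideal.Quotient.mk_surjective f
  have h : Represents F (Mero.mk F hF) := ⟨hF, rfl⟩
  exact (h.translate 0).eq h (Eventually.of_forall fun x => by rw [add_zero])

lemma T_T (α β : E) (f : Mero E) : T α (T β f) = T (α + β) f := by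
  obtain ⟨⟨F, hF⟩, rfl⟩ := Ideal.Quotient.mk_surjective f
  have h : Represents F (Mero.mk F hF) := ⟨hF, rfl⟩
  exact ((h.translate β).translate α).eq (h.translate (α + β))
    (Eventually.of_forall fun x => by simp only [add_assoc])

/-- A function that is analytic on the whole space and not identically zero is nonzero at generic
points. -/
lemma eventually_residual_ne_zero {F : E → ℂ} (hF : ∀ x, AnalyticAt ℂ F x) {x₀ : E}
    (h₀ : F x₀ ≠ 0) : ∀ᶠ x in residual E, F x ≠ 0 := by
  refine residual_of_dense_open ?_ ?_
  · exact isOpen_compl_singleton.preimage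
      (continuous_iff_continuousAt.2 fun x => (hF x).continuousAt)
  · rw [← Set.compl_ofPred, ← interior_eq_empty_iff_dense_compl, Set.eq_empty_iff_forall_notMem]
    intro y hy
    have h1 : ∀ᶠ x in 𝓝 y, F x = 0 := mem_interior_iff_mem_nhds.1 hy
    have han : AnalyticOnNhd ℂ F Set.univ := fun x _ => hF x
    have hU : IsPreconnected (Set.univ : Set E) := by
      let _ : NormedSpace ℝ E := NormedSpace.restrictScalars ℝ ℂ E
      exact isPreconnected_univ
    exact h₀ (han.eqOn_zero_of_preconnected_of_eventuallyEq_zero hU (Set.mem_univ y) h1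
      (Set.mem_univ x₀))

end Represents

section Weights

variable (P : EllipticParams) {n : ℕ}

/-- The exponential `q ^ (2 ζ_ab)` of the coordinate `ζ_ab`. -/
def qpair (a b : Fin n) (ζ : CartanDual n) : ℂ := qpow P (2 * pair ζ a b)

lemma qpow_add (s s' : ℂ) : qpow P (s + s') = qpow P s * qpow P s' :=
  Complex.cpow_add _ _ (q_ne_zero P)

lemma qpow_neg (s : ℂ) : qpow P (-s) = (qpow P s)⁻¹ := Complex.cpow_neg _ _

lemma qpow_two : qpow P 2 = (P.q : ℂ) ^ 2 := by
  rw [qpow]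
  exact_mod_cast Complex.cpow_natCast (P.q : ℂ) 2

lemma qpair_ne_zero (a b : Fin n) (ζ : CartanDual n) : qpair P a b ζ ≠ 0 := qpow_ne_zero P _

lemma pair_swap (ζ : CartanDual n) (a b : Fin n) : pair ζ b a = -pair ζ a b := by
  have : (coroot b a : Cartan n) = -coroot a b := by
    ext1
    simp [coroot]
  rw [pair, this, map_neg, pair]

lemma pair_add_pair (ζ : CartanDual n) (a b c : Fin n) : pair ζ a b + pair ζ b c = pair ζ a c := by
  have : (coroot a b + coroot b c : Cartan n) = coroot a c := by
    ext1
    simp [coroot]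
  rw [pair, pair, pair, ← map_add, this]

lemma omega_coroot (c a b : Fin n) :
    (omega c : CartanDual n) (coroot a b) = (if c = a then 1 else 0) - if c = b then 1 else 0 := by
  change (Pi.single a 1 - Pi.single b 1 : Fin n → ℂ) c = _
  simp [Pi.single_apply]

lemma qpair_inv (a b : Fin n) (ζ : CartanDual n) : qpair P b a ζ = (qpair P a b ζ)⁻¹ := by
  rw [qpair, pair_swap, mul_neg, qpow_neg, qpair]

lemma qpair_mul_qpair (a b c : Fin n) (ζ : CartanDual n) :
    qpair P a b ζ * qpair P b c ζ = qpair P a c ζ := by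
  rw [qpair, qpair, ← qpow_add, ← mul_add, pair_add_pair, qpair]

/-- Translating by `- ω(c)` does not change `q ^ (2 ζ_ab)` if `c` differs from `a` and `b`. -/
lemma qpair_add_neg_omega {a b c : Fin n} (ha : c ≠ a) (hb : c ≠ b) (ζ : CartanDual n) :
    qpair P a b (ζ + -omega c) = qpair P a b ζ := by
  have : pair (ζ + -omega c) a b = pair ζ a b := by
    simp [pair, omega_coroot, ha, hb]
  rw [qpair, this, qpair]

lemma mul_qpair_add_neg_omega {a b : Fin n} (h : a ≠ b) (ζ : CartanDual n) :
    (P.q : ℂ) ^ 2 * qpair P a b (ζ + -omega a) = qpair P a b ζ := by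
  have : pair (ζ + -omega a) a b = pair ζ a b - 1 := by
    simp [pair, omega_coroot, h, sub_eq_add_neg]
  rw [qpair, this, ← qpow_two, ← qpow_add, qpair]
  congr 1
  ring

lemma eventually_theta_qpair_ne_zero {a b : Fin n} (h : a ≠ b) :
    ∀ᶠ ζ in residual (CartanDual n), theta P (qpair P a b ζ) ≠ 0 := by
  have han : ∀ ζ : CartanDual n, AnalyticAt ℂ (fun ζ => theta P (qpair P a b ζ)) ζ := fun ζ => by
    have := analyticAt_theta_qpow P ((analyticAt_const (v := (2 : ℂ))).mul (analyticAt_pair a b ζ))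
      one_ne_zero
    simp only [mul_one] at this
    exact this
  have hlog : Complex.log (P.q : ℂ) ≠ 0 := by
    rw [← Complex.ofReal_log P.q_pos.le]
    exact_mod_cast (Real.log_neg P.q_pos P.q_lt_one).ne
  -- at this point `q ^ (2 ζ_ab) = -1`
  let s : ℂ := Real.pi * Complex.I / Complex.log (P.q : ℂ) / 2
  refine eventually_residual_ne_zero han (x₀ := s • omega a) ?_
  have : pair (s • omega a : CartanDual n) a b = s := by
    simp [pair, omega_coroot, h]
  rw [qpair, this, qpow, Complex.cpow_def_of_ne_zero (q_ne_zero P)]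
  have : Complex.log (P.q : ℂ) * (2 * s) = Real.pi * Complex.I := by
    simp only [s]
    field_simp
  rw [this, Complex.exp_pi_mul_I]
  exact theta_neg_one_ne_zero P

lemma eventually_translate {E : Type} [NormedAddCommGroup E] [NormedSpace ℂ E] {p : E → Prop}
    (h : ∀ᶠ x in residual E, p x) (α : E) : ∀ᶠ x in residual E, p (x + α) := by
  have : ∀ᶠ x in map (Homeomorph.addRight α) (residual E), p x := by
    rwa [Homeomorph.residual_map_eq]
  exact this

/-- The diagonal matrix element `e_a ⊗ e_b ↦ e_a ⊗ e_b` of the regularized R-matrix. -/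
def diagR (z : ℂˣ) (a b : Fin n) : Mero (CartanDual n) := regR P a b a b z

/-- The matrix element `e_a ⊗ e_b ↦ e_b ⊗ e_a` of the regularized R-matrix, read as zero for
`a = b`, where this is the diagonal matrix element. -/
def swapR (z : ℂˣ) (a b : Fin n) : Mero (CartanDual n) := if a = b then 0 else regR P b a a b z

lemma swapR_self (z : ℂˣ) (a : Fin n) : swapR P z a a = 0 := if_pos rfl

lemma represents_diagR_self (z : ℂˣ) (a : Fin n) :
    Represents (fun _ => theta P ((P.q : ℂ) ^ 2 * z)) (diagR P z a a) := by
  have : (regRcoef P a a a a (z : ℂ) : CartanDual n → ℂ) =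
      fun _ => theta P ((P.q : ℂ) ^ 2 * z) := by
    funext ζ
    simp [regRcoef]
  exact this ▸ ⟨isMero_regRcoef P a a a a z, rfl⟩

lemma represents_diagR {a b : Fin n} (h : a ≠ b) (z : ℂˣ) :
    Represents (fun ζ => diagWeight P ((P.q : ℂ) ^ 2) (qpair P a b ζ) z) (diagR P z a b) := by
  have : (regRcoef P a b a b (z : ℂ) : CartanDual n → ℂ) =
      fun ζ => diagWeight P ((P.q : ℂ) ^ 2) (qpair P a b ζ) z := by
    funext ζ
    rw [regRcoef, if_neg h, if_pos ⟨rfl, rfl⟩, diagWeight, qpair, ← qpow_two, ← qpow_add]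
    congr 4
    ring
  exact this ▸ ⟨isMero_regRcoef P a b a b z, rfl⟩

lemma represents_swapR {a b : Fin n} (h : a ≠ b) (z : ℂˣ) :
    Represents (fun ζ => swapWeight P ((P.q : ℂ) ^ 2) (qpair P a b ζ) z) (swapR P z a b) := by
  have : (regRcoef P b a a b (z : ℂ) : CartanDual n → ℂ) =
      fun ζ => swapWeight P ((P.q : ℂ) ^ 2) (qpair P a b ζ) z := by
    funext ζ
    have h' : -2 * pair ζ b a = 2 * pair ζ a b := by rw [pair_swap]; ring
    rw [regRcoef, if_neg h, if_neg (fun H => h H.2), if_pos ⟨rfl, rfl⟩, h', swapWeight, qpair]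
  rw [swapR, if_neg h]
  exact this ▸ ⟨isMero_regRcoef P b a a b z, rfl⟩

end Weights

/-! ### The dynamical Yang–Baxter equation -/

/-! The weight identities as identities between meromorphic functions.  A suffix such as `abc_bca`
gives the column and the row of the matrix element; only the rows that do not follow from
`T_diagR_mul_comm` need an identity of their own. -/

section WeightIdentities

variable (P : EllipticParams) {n : ℕ} (u v : ℂˣ) {a b c : Fin n}

@[simp]
lemma T_diagR_self (α : CartanDual n) (z : ℂˣ) (a : Fin n) :
    T α (diagR P z a a) = diagR P z a a :=
  ((represents_diagR_self P z a).translate α).eq (represents_diagR_self P z a)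
    (Eventually.of_forall fun _ => rfl)

lemma T_diagR_of_ne (z : ℂˣ) (hab : a ≠ b) (ha : c ≠ a) (hb : c ≠ b) :
    T (-omega c) (diagR P z a b) = diagR P z a b :=
  ((represents_diagR P hab z).translate _).eq (represents_diagR P hab z)
    (Eventually.of_forall fun ζ => by rw [qpair_add_neg_omega P ha hb])

lemma T_swapR_of_ne (z : ℂˣ) (hab : a ≠ b) (ha : c ≠ a) (hb : c ≠ b) :
    T (-omega c) (swapR P z a b) = swapR P z a b :=
  ((represents_swapR P hab z).translate _).eq (represents_swapR P hab z)
    (Eventually.of_forall fun ζ => by rw [qpair_add_neg_omega P ha hb])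

/-- The spectral parameters of two diagonal weights can be exchanged, as they only enter through the
factor `θ(z)`. -/
lemma T_diagR_mul_comm {α β : CartanDual n} {a' b' : Fin n} (h : a ≠ b) (h' : a' ≠ b') :
    T α (diagR P u a b) * T β (diagR P v a' b') = T α (diagR P v a b) * T β (diagR P u a' b') :=
  (((represents_diagR P h u).translate α).mul ((represents_diagR P h' v).translate β)).eq
    (((represents_diagR P h v).translate α).mul ((represents_diagR P h' u).translate β))
    (Eventually.of_forall fun ζ => by unfold diagWeight; ring)

lemma R_abc_bca (hab : a ≠ b) (hbc : b ≠ c) (hac : a ≠ c) :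
    swapR P v b c * swapR P (u * v) a b * diagR P u b c +
      diagR P v b c * swapR P (u * v) a c * swapR P u c b =
    swapR P u a b * diagR P (u * v) b c * swapR P v a c := by
  refine ((((represents_swapR P hbc v).mul (represents_swapR P hab (u * v))).mul
    (represents_diagR P hbc u)).add (((represents_diagR P hbc v).mul
    (represents_swapR P hac (u * v))).mul (represents_swapR P hbc.symm u))).eq
    (((represents_swapR P hab u).mul (represents_diagR P hbc (u * v))).mul
      (represents_swapR P hac v)) ?_
  filter_upwards [eventually_theta_qpair_ne_zero P hab, eventually_theta_qpair_ne_zero P hbc,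
    eventually_theta_qpair_ne_zero P hac] with ζ h1 h2 h3
  rw [qpair_inv P b c, ← qpair_mul_qpair P a b c] at *
  exact weights_abc_bca P u.ne_zero v.ne_zero (qpair_ne_zero P _ _ _) (qpair_ne_zero P _ _ _)
    h1 h2 h3

lemma R_abc_cab (hab : a ≠ b) (hbc : b ≠ c) (hac : a ≠ c) :
    swapR P v b c * diagR P (u * v) a b * swapR P u a c =
    swapR P u a b * swapR P (u * v) b c * diagR P v a b +
      diagR P u a b * swapR P (u * v) a c * swapR P v b a := by
  refine (((represents_swapR P hbc v).mul (represents_diagR P hab (u * v))).mul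
    (represents_swapR P hac u)).eq ((((represents_swapR P hab u).mul
    (represents_swapR P hbc (u * v))).mul (represents_diagR P hab v)).add
    (((represents_diagR P hab u).mul (represents_swapR P hac (u * v))).mul
    (represents_swapR P hab.symm v))) ?_
  filter_upwards [eventually_theta_qpair_ne_zero P hab, eventually_theta_qpair_ne_zero P hbc,
    eventually_theta_qpair_ne_zero P hac] with ζ h1 h2 h3
  rw [qpair_inv P a b, ← qpair_mul_qpair P a b c] at *
  exact weights_abc_cab P u.ne_zero v.ne_zero (qpair_ne_zero P _ _ _) (qpair_ne_zero P _ _ _)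
    h1 h2 h3

lemma R_abc_cba (hab : a ≠ b) (hbc : b ≠ c) (hac : a ≠ c) :
    diagR P v b c * swapR P (u * v) a c * diagR P u c b +
      swapR P v b c * swapR P (u * v) a b * swapR P u b c =
    diagR P u a b * swapR P (u * v) a c * diagR P v b a +
      swapR P u a b * swapR P (u * v) b c * swapR P v a b := by
  refine Represents.eq ((((represents_diagR P hbc v).mul
    (represents_swapR P hac (u * v))).mul (represents_diagR P hbc.symm u)).add
    (((represents_swapR P hbc v).mul
    (represents_swapR P hab (u * v))).mul (represents_swapR P hbc u)))
    ((((represents_diagR P hab u).mul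
    (represents_swapR P hac (u * v))).mul (represents_diagR P hab.symm v)).add
    (((represents_swapR P hab u).mul
    (represents_swapR P hbc (u * v))).mul (represents_swapR P hab v))) ?_
  filter_upwards [eventually_theta_qpair_ne_zero P hab, eventually_theta_qpair_ne_zero P hbc,
    eventually_theta_qpair_ne_zero P hac] with ζ h1 h2 h3
  rw [qpair_inv P b c, qpair_inv P a b, ← qpair_mul_qpair P a b c] at *
  exact weights_abc_cba P (pow_ne_zero 2 (q_ne_zero P)) u.ne_zero v.ne_zero
    (qpair_ne_zero P _ _ _) (qpair_ne_zero P _ _ _) h1 h2 h3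

lemma R_aab_baa (hab : a ≠ b) :
    T (-omega a) (diagR P v a b) * swapR P (u * v) a b * T (-omega a) (diagR P u b a) +
      T (-omega a) (swapR P v a b) * diagR P (u * v) a a * T (-omega a) (swapR P u a b) =
    diagR P u a a * T (-omega a) (swapR P (u * v) a b) * diagR P v a a := by
  refine Represents.eq (((((represents_diagR P hab v).translate (-omega a)).mul
    (represents_swapR P hab (u * v))).mul ((represents_diagR P hab.symm u).translate (-omega a))).add
    ((((represents_swapR P hab v).translate (-omega a)).mul
    (represents_diagR_self P (u * v) a)).mul ((represents_swapR P hab u).translate (-omega a))))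
    (((represents_diagR_self P u a).mul
    ((represents_swapR P hab (u * v)).translate (-omega a))).mul (represents_diagR_self P v a)) ?_
  filter_upwards [eventually_theta_qpair_ne_zero P hab,
    eventually_translate (eventually_theta_qpair_ne_zero P hab) (-omega a)] with ζ h1 h2
  simp only [qpair_inv P a b, ← mul_qpair_add_neg_omega P hab ζ] at *
  exact weights_aab_baa P (pow_ne_zero 2 (q_ne_zero P)) u.ne_zero v.ne_zero
    (qpair_ne_zero P _ _ _) h2 h1

lemma R_aab_aba (hab : a ≠ b) :
    T (-omega a) (swapR P v a b) * diagR P (u * v) a a * T (-omega a) (diagR P u a b) +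
      T (-omega a) (diagR P v a b) * swapR P (u * v) a b * T (-omega a) (swapR P u b a) =
    diagR P u a a * T (-omega a) (diagR P (u * v) a b) * swapR P v a b := by
  refine Represents.eq (((((represents_swapR P hab v).translate (-omega a)).mul
    (represents_diagR_self P (u * v) a)).mul ((represents_diagR P hab u).translate (-omega a))).add
    ((((represents_diagR P hab v).translate (-omega a)).mul
    (represents_swapR P hab (u * v))).mul ((represents_swapR P hab.symm u).translate (-omega a))))
    (((represents_diagR_self P u a).mul
    ((represents_diagR P hab (u * v)).translate (-omega a))).mul (represents_swapR P hab v)) ?_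
  filter_upwards [eventually_theta_qpair_ne_zero P hab,
    eventually_translate (eventually_theta_qpair_ne_zero P hab) (-omega a)] with ζ h1 h2
  simp only [qpair_inv P a b, ← mul_qpair_add_neg_omega P hab ζ] at *
  exact weights_aab_aba P (pow_ne_zero 2 (q_ne_zero P)) u.ne_zero v.ne_zero
    (qpair_ne_zero P _ _ _) h2 h1

lemma R_aba_baa (hab : a ≠ b) :
    T (-omega a) (diagR P v b a) * diagR P (u * v) a a * T (-omega a) (swapR P u a b) +
      T (-omega a) (swapR P v b a) * swapR P (u * v) a b * T (-omega a) (diagR P u b a) =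
    swapR P u a b * T (-omega a) (diagR P (u * v) b a) * diagR P v a a := by
  refine Represents.eq (((((represents_diagR P hab.symm v).translate (-omega a)).mul
    (represents_diagR_self P (u * v) a)).mul ((represents_swapR P hab u).translate (-omega a))).add
    ((((represents_swapR P hab.symm v).translate (-omega a)).mul
    (represents_swapR P hab (u * v))).mul ((represents_diagR P hab.symm u).translate (-omega a))))
    (((represents_swapR P hab u).mul
    ((represents_diagR P hab.symm (u * v)).translate (-omega a))).mul (represents_diagR_self P v a)) ?_
  filter_upwards [eventually_theta_qpair_ne_zero P hab,
    eventually_translate (eventually_theta_qpair_ne_zero P hab) (-omega a)] with ζ h1 h2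
  simp only [qpair_inv P a b, ← mul_qpair_add_neg_omega P hab ζ] at *
  exact weights_aba_baa P (pow_ne_zero 2 (q_ne_zero P)) u.ne_zero v.ne_zero
    (qpair_ne_zero P _ _ _) h2 h1

lemma R_aba_aab (hab : a ≠ b) :
    T (-omega a) (swapR P v b a) * diagR P (u * v) a b * diagR P u a a =
    diagR P u a b * diagR P (u * v) a a * swapR P v b a +
      swapR P u a b * T (-omega a) (swapR P (u * v) b a) * diagR P v a b := by
  refine Represents.eq ((((represents_swapR P hab.symm v).translate (-omega a)).mul
    (represents_diagR P hab (u * v))).mul (represents_diagR_self P u a))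
    ((((represents_diagR P hab u).mul
    (represents_diagR_self P (u * v) a)).mul (represents_swapR P hab.symm v)).add
    (((represents_swapR P hab u).mul
    ((represents_swapR P hab.symm (u * v)).translate (-omega a))).mul (represents_diagR P hab v))) ?_
  filter_upwards [eventually_theta_qpair_ne_zero P hab,
    eventually_translate (eventually_theta_qpair_ne_zero P hab) (-omega a)] with ζ h1 h2
  simp only [qpair_inv P a b, ← mul_qpair_add_neg_omega P hab ζ] at *
  exact weights_aba_aab P (pow_ne_zero 2 (q_ne_zero P)) u.ne_zero v.ne_zero
    (qpair_ne_zero P _ _ _) h2 h1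

lemma R_aba_aba (hab : a ≠ b) :
    T (-omega a) (diagR P v b a) * diagR P (u * v) a a * T (-omega a) (diagR P u a b) +
      T (-omega a) (swapR P v b a) * swapR P (u * v) a b * T (-omega a) (swapR P u b a) =
    diagR P u a b * diagR P (u * v) a a * diagR P v b a +
      swapR P u a b * T (-omega a) (swapR P (u * v) b a) * swapR P v a b := by
  refine Represents.eq (((((represents_diagR P hab.symm v).translate (-omega a)).mul
    (represents_diagR_self P (u * v) a)).mul ((represents_diagR P hab u).translate (-omega a))).add
    ((((represents_swapR P hab.symm v).translate (-omega a)).mul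
    (represents_swapR P hab (u * v))).mul ((represents_swapR P hab.symm u).translate (-omega a))))
    ((((represents_diagR P hab u).mul
    (represents_diagR_self P (u * v) a)).mul (represents_diagR P hab.symm v)).add
    (((represents_swapR P hab u).mul
    ((represents_swapR P hab.symm (u * v)).translate (-omega a))).mul (represents_swapR P hab v))) ?_
  filter_upwards [eventually_theta_qpair_ne_zero P hab,
    eventually_translate (eventually_theta_qpair_ne_zero P hab) (-omega a)] with ζ h1 h2
  simp only [qpair_inv P a b, ← mul_qpair_add_neg_omega P hab ζ] at *
  exact weights_aba_aba P (pow_ne_zero 2 (q_ne_zero P)) u.ne_zero v.ne_zero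
    (qpair_ne_zero P _ _ _) h2 h1

lemma R_baa_aba (hab : a ≠ b) :
    diagR P v a a * diagR P (u * v) b a * T (-omega a) (swapR P u b a) =
    diagR P u b a * T (-omega a) (swapR P (u * v) b a) * swapR P v a b +
      swapR P u b a * diagR P (u * v) a a * diagR P v b a := by
  refine Represents.eq (((represents_diagR_self P v a).mul
    (represents_diagR P hab.symm (u * v))).mul ((represents_swapR P hab.symm u).translate (-omega a)))
    ((((represents_diagR P hab.symm u).mul
    ((represents_swapR P hab.symm (u * v)).translate (-omega a))).mul (represents_swapR P hab v)).add
    (((represents_swapR P hab.symm u).mul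
    (represents_diagR_self P (u * v) a)).mul (represents_diagR P hab.symm v))) ?_
  filter_upwards [eventually_theta_qpair_ne_zero P hab,
    eventually_translate (eventually_theta_qpair_ne_zero P hab) (-omega a)] with ζ h1 h2
  simp only [qpair_inv P a b, ← mul_qpair_add_neg_omega P hab ζ] at *
  exact weights_baa_aba P (pow_ne_zero 2 (q_ne_zero P)) u.ne_zero v.ne_zero
    (qpair_ne_zero P _ _ _) h2 h1

lemma R_baa_aab (hab : a ≠ b) :
    diagR P v a a * swapR P (u * v) b a * diagR P u a a =
    diagR P u b a * T (-omega a) (swapR P (u * v) b a) * diagR P v a b +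
      swapR P u b a * diagR P (u * v) a a * swapR P v b a := by
  refine Represents.eq (((represents_diagR_self P v a).mul
    (represents_swapR P hab.symm (u * v))).mul (represents_diagR_self P u a))
    ((((represents_diagR P hab.symm u).mul
    ((represents_swapR P hab.symm (u * v)).translate (-omega a))).mul (represents_diagR P hab v)).add
    (((represents_swapR P hab.symm u).mul
    (represents_diagR_self P (u * v) a)).mul (represents_swapR P hab.symm v))) ?_
  filter_upwards [eventually_theta_qpair_ne_zero P hab,
    eventually_translate (eventually_theta_qpair_ne_zero P hab) (-omega a)] with ζ h1 h2
  simp only [qpair_inv P a b, ← mul_qpair_add_neg_omega P hab ζ] at *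
  exact weights_baa_aab P (pow_ne_zero 2 (q_ne_zero P)) u.ne_zero v.ne_zero
    (qpair_ne_zero P _ _ _) h2 h1

end WeightIdentities

section YangBaxter

variable (P : EllipticParams) {n m : ℕ}

/-- The label obtained from `a` by putting `x`, `y`, `w` at the positions `i`, `j`, `k`. -/
def triple (a : Idx n m) (i j k : Fin m) (x y w : Fin n) : Idx n m := fun l =>
  if l = i then x else if l = j then y else if l = k then w else a l

/-- The regularized R-matrix in the legs `i`, `j` is the sum of a diagonal operator and of one that
exchanges the two legs. -/
lemma legR_apply {i j : Fin m} (z : ℂˣ) (b a : Idx n m) :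
    (legR P i j z : DynOp n m) b a = (if b = a then diagR P z (a i) (a j) else 0) +
      if b = a ∘ Equiv.swap i j then swapR P z (a i) (a j) else 0 := by
  have hmk : ∀ (x y a b : Fin n) (h : (regRcoef P x y a b (z : ℂ) : CartanDual n → ℂ) =
      fun _ => 0), regR P x y a b z = 0 := fun x y a b h =>
    Represents.eq (F := regRcoef P x y a b (z : ℂ)) (G := fun _ => 0) ⟨_, rfl⟩
      ⟨IsMero.of_analytic fun _ => analyticAt_const, rfl⟩ (Eventually.of_forall fun ζ => by rw [h])
  rw [legR]
  by_cases hb : ∀ k, k ≠ i → k ≠ j → b k = a k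
  · rw [if_pos hb]
    have e1 : b = a ↔ b i = a i ∧ b j = a j := by
      refine ⟨by rintro rfl; exact ⟨rfl, rfl⟩, fun h => funext fun k => ?_⟩
      by_cases h1 : k = i
      · rw [h1, h.1]
      by_cases h2 : k = j
      · rw [h2, h.2]
      exact hb k h1 h2
    have e2 : b = a ∘ Equiv.swap i j ↔ b i = a j ∧ b j = a i := by
      refine ⟨by rintro rfl; simp, fun h => funext fun k => ?_⟩
      by_cases h1 : k = i
      · simp [h1, h.1]
      by_cases h2 : k = j
      · simp [h2, h.2]
      rw [hb k h1 h2, Function.comp_apply, Equiv.swap_apply_of_ne_of_ne h1 h2]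
    simp only [e1, e2]
    by_cases ha : a i = a j
    · rw [ha, swapR_self, ite_self, add_zero]
      split_ifs with h
      · rw [h.1, h.2, diagR]
      · exact hmk _ _ _ _ (funext fun ζ => by rw [regRcoef, if_pos rfl, if_neg h])
    · rw [swapR, if_neg ha]
      by_cases h1 : b i = a i ∧ b j = a j
      · rw [if_pos h1, if_neg (fun h => ha (h1.1.symm.trans h.1)), add_zero, h1.1, h1.2, diagR]
      · rw [if_neg h1, zero_add]
        split_ifs with h2
        · rw [h2.1, h2.2]
        · exact hmk _ _ _ _ (funext fun ζ => by
            rw [regRcoef, if_neg ha, if_neg h1, if_neg h2])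
  · rw [if_neg hb, if_neg, if_neg, add_zero]
    · rintro rfl
      exact hb fun k h1 h2 => by
        rw [Function.comp_apply, Equiv.swap_apply_of_ne_of_ne h1 h2]
    · rintro rfl
      exact hb fun k _ _ => rfl

/-- Multiplying by an R-matrix from the right affects only the columns `a` and `a ∘ (i j)`. -/
lemma mul_shift_legR_apply {i j : Fin m} (z : ℂˣ) (c : Fin m → ℤ) (M : DynOp n m)
    (b a : Idx n m) :
    (M * shift c (legR P i j z) : DynOp n m) b a =
      M b a * T (∑ l, c l • omega (a l)) (diagR P z (a i) (a j)) +
      M b (a ∘ Equiv.swap i j) * T (∑ l, c l • omega (a l)) (swapR P z (a i) (a j)) := by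
  rw [Matrix.mul_apply]
  simp only [shift, legR_apply P, map_add, mul_add, Finset.sum_add_distrib, apply_ite (T _),
    map_zero, mul_ite, mul_zero, Finset.sum_ite_eq', Finset.mem_univ, if_true]

lemma shift_zero (A : DynOp n m) : shift 0 A = A := by
  funext b a
  simp [shift, T_zero]

lemma mul_legR_apply {i j : Fin m} (z : ℂˣ) (M : DynOp n m) (b a : Idx n m) :
    (M * legR P i j z : DynOp n m) b a = M b a * diagR P z (a i) (a j) +
      M b (a ∘ Equiv.swap i j) * swapR P z (a i) (a j) := by
  have := mul_shift_legR_apply P (i := i) (j := j) z 0 M b a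
  simpa [shift_zero, T_zero] using this

lemma mul_shift_neg_single_legR_apply {i j : Fin m} (z : ℂˣ) (k : Fin m)
    (M : DynOp n m) (b a : Idx n m) :
    (M * shift (-Pi.single k 1) (legR P i j z) : DynOp n m) b a =
      M b a * T (-omega (a k)) (diagR P z (a i) (a j)) +
      M b (a ∘ Equiv.swap i j) * T (-omega (a k)) (swapR P z (a i) (a j)) := by
  rw [mul_shift_legR_apply P]
  simp [Pi.single_apply]

section Triple

variable {i j k : Fin m} (a : Idx n m) (x y w : Fin n)

lemma triple_fst : triple a i j k x y w i = x := by simp [triple]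

lemma triple_snd (hij : i ≠ j) : triple a i j k x y w j = y := by simp [triple, hij.symm]

lemma triple_trd (hik : i ≠ k) (hjk : j ≠ k) : triple a i j k x y w k = w := by
  simp [triple, hik.symm, hjk.symm]

lemma triple_self : triple a i j k (a i) (a j) (a k) = a := by
  funext l
  unfold triple
  split_ifs <;> simp_all

lemma triple_comp_swap_fst_snd (hij : i ≠ j) (hik : i ≠ k) (hjk : j ≠ k) :
    triple a i j k x y w ∘ Equiv.swap i j = triple a i j k y x w := by
  funext l
  simp only [triple, Function.comp_apply, Equiv.swap_apply_def]
  split_ifs <;> simp_all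

lemma triple_comp_swap_fst_trd (hij : i ≠ j) (hik : i ≠ k) (hjk : j ≠ k) :
    triple a i j k x y w ∘ Equiv.swap i k = triple a i j k w y x := by
  funext l
  simp only [triple, Function.comp_apply, Equiv.swap_apply_def]
  split_ifs <;> simp_all

lemma triple_comp_swap_snd_trd (hij : i ≠ j) (hik : i ≠ k) (hjk : j ≠ k) :
    triple a i j k x y w ∘ Equiv.swap j k = triple a i j k x w y := by
  funext l
  simp only [triple, Function.comp_apply, Equiv.swap_apply_def]
  split_ifs <;> simp_all

end Triple

/-- The matrix elements of the dynamical Yang–Baxter equation in the column `e_x ⊗ e_y ⊗ e_w`, where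
`E` is an arbitrary row vector from which both sides are expanded. -/
lemma yangBaxter_column (u v : ℂˣ) (E : Fin n → Fin n → Fin n → Mero (CartanDual n))
    (x y w : Fin n) :
    ((E x y w * T (-omega w) (diagR P u x y) + E y x w * T (-omega w) (swapR P u x y)) *
          diagR P (u * v) x w +
        (E w y x * T (-omega x) (diagR P u w y) + E y w x * T (-omega x) (swapR P u w y)) *
          swapR P (u * v) x w) * T (-omega x) (diagR P v y w) +
      ((E x w y * T (-omega y) (diagR P u x w) + E w x y * T (-omega y) (swapR P u x w)) *
          diagR P (u * v) x y +
        (E y w x * T (-omega x) (diagR P u y w) + E w y x * T (-omega x) (swapR P u y w)) *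
          swapR P (u * v) x y) * T (-omega x) (swapR P v y w) =
    ((E x y w * diagR P v y w + E x w y * swapR P v y w) * T (-omega y) (diagR P (u * v) x w) +
        (E w y x * diagR P v y x + E w x y * swapR P v y x) *
          T (-omega y) (swapR P (u * v) x w)) * diagR P u x y +
      ((E y x w * diagR P v x w + E y w x * swapR P v x w) * T (-omega x) (diagR P (u * v) y w) +
        (E w x y * diagR P v x y + E w y x * swapR P v x y) *
          T (-omega x) (swapR P (u * v) y w)) * swapR P u x y := by
  by_cases hxy : x = y
  · subst hxy
    by_cases hxw : x = w
    · subst hxw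
      simp only [swapR_self, map_zero, mul_zero, add_zero, T_diagR_self]
      ring
    · simp only [swapR_self, map_zero, mul_zero, add_zero, T_diagR_self]
      have h1 := R_aab_baa P u v hxw
      have h2 := R_aab_aba P u v hxw
      have h3 := T_diagR_mul_comm P (u * v) v (α := 0) (β := -omega x) hxw hxw
      simp only [T_zero] at h3
      linear_combination E w x x * h1 + E x w x * h2 + E x x w * diagR P u x x * h3
  · by_cases hxw : x = w
    · subst hxw
      simp only [swapR_self, map_zero, mul_zero, add_zero, T_diagR_self]
      have h1 := R_aba_aba P u v hxy
      have h2 := R_aba_aab P u v hxy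
      have h3 := R_aba_baa P u v hxy
      linear_combination E x y x * h1 + E x x y * h2 + E y x x * h3
    · by_cases hyw : y = w
      · subst hyw
        simp only [swapR_self, map_zero, mul_zero, add_zero, T_diagR_self]
        have h1 := R_baa_aba P u v (Ne.symm hxy)
        have h2 := R_baa_aab P u v (Ne.symm hxy)
        have h3 := T_diagR_mul_comm P (u * v) u (α := 0) (β := -omega y) hxy hxy
        simp only [T_zero] at h3
        linear_combination E y x y * h1 + E y y x * h2 + E x y y * diagR P v y y * h3
      · have hwy := Ne.symm hyw
        simp only [T_diagR_of_ne P _ hxy (Ne.symm hxw) hwy,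
          T_swapR_of_ne P _ hxy (Ne.symm hxw) hwy, T_diagR_of_ne P _ hyw hxy hxw,
          T_swapR_of_ne P _ hyw hxy hxw, T_diagR_of_ne P _ hwy hxw hxy,
          T_swapR_of_ne P _ hwy hxw hxy, T_diagR_of_ne P _ hxw (Ne.symm hxy) hyw,
          T_swapR_of_ne P _ hxw (Ne.symm hxy) hyw]
        have h1 := R_abc_bca P u v hxy hyw hxw
        have h2 := R_abc_cab P u v hxy hyw hxw
        have h3 := R_abc_cba P u v hxy hyw hxw
        have h4 := T_diagR_mul_comm P (u * v) u (α := 0) (β := 0) hxy hxw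
        have h5 := T_diagR_mul_comm P (u * v) v (α := 0) (β := 0) hxw hyw
        simp only [T_zero] at h4 h5
        linear_combination E y w x * h1 + E w x y * h2 + E w y x * h3 +
          E x w y * swapR P v y w * h4 + E y x w * swapR P u x y * h5

/-- The **dynamical Yang–Baxter equation** for the regularized R-matrix, in three different legs
`i`, `j`, `k`. -/
theorem dynamical_yangBaxter {i j k : Fin m} (hij : i ≠ j) (hik : i ≠ k) (hjk : j ≠ k)
    (u v : ℂˣ) :
    (shift (-Pi.single k 1) (legR P i j u) * legR P i k (u * v) *
        shift (-Pi.single i 1) (legR P j k v) : DynOp n m) =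
      legR P j k v * shift (-Pi.single j 1) (legR P i k (u * v)) * legR P i j u := by
  -- The additional left factor `M` allows the columns to be expanded one R-matrix at a time.
  have key : ∀ (M : DynOp n m) (b a : Idx n m) (x y w : Fin n),
      (M * shift (-Pi.single k 1) (legR P i j u) * legR P i k (u * v) *
        shift (-Pi.single i 1) (legR P j k v) : DynOp n m) b (triple a i j k x y w) =
      (M * legR P j k v * shift (-Pi.single j 1) (legR P i k (u * v)) * legR P i j u : DynOp n m)
        b (triple a i j k x y w) := by
    intro M b a x y w
    simp only [mul_shift_neg_single_legR_apply P (i := i) (j := j),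
      mul_shift_neg_single_legR_apply P (i := i) (j := k),
      mul_shift_neg_single_legR_apply P (i := j) (j := k), mul_legR_apply P (i := i) (j := j),
      mul_legR_apply P (i := i) (j := k), mul_legR_apply P (i := j) (j := k),
      triple_comp_swap_fst_snd _ _ _ _ hij hik hjk, triple_comp_swap_fst_trd _ _ _ _ hij hik hjk,
      triple_comp_swap_snd_trd _ _ _ _ hij hik hjk,
      triple_fst, triple_snd _ _ _ _ hij, triple_trd _ _ _ _ hik hjk]
    exact yangBaxter_column P u v (fun x y w => M b (triple a i j k x y w)) x y w
  funext b a
  have := key 1 b a (a i) (a j) (a k)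
  rwa [triple_self, one_mul, one_mul] at this

end YangBaxter

/-! ### Dynamical shifts and permutations of tensor factors -/

section Dyn

variable {n m : ℕ}

/-- The operator `A` preserves the weight `∑_k c_k h^k`. -/
def PreservesWeight (c : Fin m → ℤ) (A : DynOp n m) : Prop :=
  ∀ b a, A b a ≠ 0 → ∑ k, c k • (omega (b k) : CartanDual n) = ∑ k, c k • omega (a k)

/-- Dynamical shifts are multiplicative on operators preserving the weight that is shifted by. -/
lemma shift_mul {c : Fin m → ℤ} {B : DynOp n m} (A : DynOp n m) (hB : PreservesWeight c B) :
    shift c (A * B) = shift c A * shift c B := by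
  funext b a
  simp only [shift, Matrix.mul_apply, map_sum, map_mul]
  refine Finset.sum_congr rfl fun x _ => ?_
  by_cases h : B x a = 0
  · rw [h, map_zero, mul_zero, mul_zero]
  · rw [hB x a h]

lemma shift_shift (c d : Fin m → ℤ) (A : DynOp n m) : shift c (shift d A) = shift (c + d) A := by
  funext b a
  simp only [shift, T_T, Pi.add_apply, add_zsmul, Finset.sum_add_distrib]

lemma one_apply (b a : Idx n m) : (1 : DynOp n m) b a = if b = a then 1 else 0 :=
  Matrix.one_apply

lemma shift_one (c : Fin m → ℤ) : shift c (1 : DynOp n m) = 1 := by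
  funext b a
  rw [shift, one_apply]
  split_ifs <;> simp

lemma PreservesWeight.one (c : Fin m → ℤ) : PreservesWeight c (1 : DynOp n m) := by
  intro b a h
  rw [one_apply] at h
  rw [(ite_ne_right_iff.1 h).1]

lemma PreservesWeight.mul {c : Fin m → ℤ} {A B : DynOp n m} (hA : PreservesWeight c A)
    (hB : PreservesWeight c B) : PreservesWeight c (A * B) := by
  intro b a h
  rw [Matrix.mul_apply] at h
  obtain ⟨x, _, hx⟩ := Finset.exists_ne_zero_of_sum_ne_zero h
  rw [hA b x (left_ne_zero_of_mul hx), hB x a (right_ne_zero_of_mul hx)]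

lemma PreservesWeight.shift {c : Fin m → ℤ} {A : DynOp n m} (hA : PreservesWeight c A)
    (d : Fin m → ℤ) : PreservesWeight c (shift d A) := by
  intro b a h
  refine hA b a fun h0 => h ?_
  rw [EllipticRLL.shift, h0, map_zero]

lemma sum_comp_perm (c : Fin m → ℤ) (σ : Equiv.Perm (Fin m)) (a : Idx n m) :
    ∑ k, c k • (omega (a (σ k)) : CartanDual n) = ∑ k, c (σ⁻¹ k) • omega (a k) := by
  rw [← Equiv.sum_comp σ fun k => c (σ⁻¹ k) • (omega (a k) : CartanDual n)]
  simp

lemma PreservesWeight.permDyn {c : Fin m → ℤ} {A : DynOp n m} {σ : Equiv.Perm (Fin m)}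
    (hA : PreservesWeight (c ∘ σ) A) : PreservesWeight c (permDyn σ A) := by
  intro b a h
  have := hA _ _ h
  simp only [Function.comp_apply] at this
  rwa [Equiv.sum_comp σ fun k => c k • (omega (b k) : CartanDual n),
    Equiv.sum_comp σ fun k => c k • (omega (a k) : CartanDual n)] at this

lemma permDyn_one (σ : Equiv.Perm (Fin m)) : permDyn σ (1 : DynOp n m) = 1 := by
  funext b a
  rw [permDyn, one_apply, one_apply]
  simp only [σ.surjective.injective_comp_right.eq_iff]

lemma permDyn_mul (σ : Equiv.Perm (Fin m)) (A B : DynOp n m) :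
    permDyn σ (A * B) = permDyn σ A * permDyn σ B := by
  funext b a
  simp only [permDyn, Matrix.mul_apply]
  exact (Equiv.sum_comp (σ.symm.arrowCongr (Equiv.refl (Fin n)))
    fun x => A (b ∘ σ) x * B x (a ∘ σ)).symm

lemma permDyn_permDyn (σ τ : Equiv.Perm (Fin m)) (A : DynOp n m) :
    permDyn σ (permDyn τ A) = permDyn (σ * τ) A := rfl

lemma permDyn_shift (σ : Equiv.Perm (Fin m)) (c : Fin m → ℤ) (A : DynOp n m) :
    permDyn σ (shift c A) = shift (c ∘ ⇑σ⁻¹) (permDyn σ A) := by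
  funext b a
  simp only [permDyn, shift, Function.comp_apply, sum_comp_perm]

lemma permDyn_legR (P : EllipticParams) (σ : Equiv.Perm (Fin m)) (i j : Fin m) (z : ℂˣ) :
    permDyn σ (legR P i j z : DynOp n m) = legR P (σ i) (σ j) z := by
  funext b a
  simp only [permDyn, legR, Function.comp_apply]
  congr 1
  refine propext ⟨fun h k h1 h2 => ?_, fun h k h1 h2 =>
    h _ (fun H => h1 (σ.injective H)) (fun H => h2 (σ.injective H))⟩
  have := h (σ⁻¹ k) (by rintro rfl; simp at h1) (by rintro rfl; simp at h2)
  simpa using this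

/-- An R-matrix exchanges at most its two legs. -/
lemma preservesWeight_legR (P : EllipticParams) {c : Fin m → ℤ} {i j : Fin m} (h : c i = c j)
    (z : ℂˣ) : PreservesWeight c (legR P i j z : DynOp n m) := by
  intro b a hba
  rw [legR_apply] at hba
  by_cases h1 : b = a
  · rw [h1]
  by_cases h2 : b = a ∘ Equiv.swap i j
  · rw [h2]
    simp only [Function.comp_apply]
    rw [sum_comp_perm, Equiv.swap_inv]
    refine Finset.sum_congr rfl fun k _ => ?_
    rcases eq_or_ne k i with rfl | hi
    · rw [Equiv.swap_apply_left, h]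
    rcases eq_or_ne k j with rfl | hj
    · rw [Equiv.swap_apply_right, h]
    rw [Equiv.swap_apply_of_ne_of_ne hi hj]
  · rw [if_neg h1, if_neg h2, add_zero] at hba
    exact absurd rfl hba

/-- R-matrices in disjoint pairs of legs commute, if the dynamical shift of either does not
distinguish the two legs of the other. -/
lemma shift_legR_commute (P : EllipticParams) {i j k l : Fin m} (hij : i ≠ j) (hkl : k ≠ l)
    (hik : i ≠ k) (hil : i ≠ l) (hjk : j ≠ k) (hjl : j ≠ l)
    {c d : Fin m → ℤ} (hc : c k = c l) (hd : d i = d j) (u v : ℂˣ) :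
    (shift c (legR P i j u) * shift d (legR P k l v) : DynOp n m) =
      shift d (legR P k l v) * shift c (legR P i j u) := by
  have hs : ∀ (e : Fin m → ℤ) (p r : Fin m) (_ : e p = e r) (a : Idx n m),
      ∑ t, e t • (omega (a (Equiv.swap p r t)) : CartanDual n) = ∑ t, e t • omega (a t) := by
    intro e p r he a
    rw [sum_comp_perm, Equiv.swap_inv]
    refine Finset.sum_congr rfl fun t _ => ?_
    rcases eq_or_ne t p with rfl | hi
    · rw [Equiv.swap_apply_left, he]
    rcases eq_or_ne t r with rfl | hj
    · rw [Equiv.swap_apply_right, he]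
    rw [Equiv.swap_apply_of_ne_of_ne hi hj]
  have hcomm : ∀ a : Idx n m, (a ∘ Equiv.swap k l) ∘ Equiv.swap i j =
      (a ∘ Equiv.swap i j) ∘ Equiv.swap k l := by
    intro a
    have : Commute (Equiv.swap i j) (Equiv.swap k l) :=
      (Equiv.Perm.disjoint_swap_swap (by simp [*])).commute
    rw [Function.comp_assoc, Function.comp_assoc, ← Equiv.Perm.coe_mul, ← Equiv.Perm.coe_mul, this]
  have key : ∀ (M : DynOp n m) (b a : Idx n m),
      (M * shift c (legR P i j u) * shift d (legR P k l v) : DynOp n m) b a =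
        (M * shift d (legR P k l v) * shift c (legR P i j u) : DynOp n m) b a := by
    intro M b a
    simp only [mul_shift_legR_apply, hcomm, Function.comp_apply, hs _ _ _ hc, hs _ _ _ hd,
      Equiv.swap_apply_of_ne_of_ne hik hil, Equiv.swap_apply_of_ne_of_ne hjk hjl,
      Equiv.swap_apply_of_ne_of_ne hik.symm hjk.symm,
      Equiv.swap_apply_of_ne_of_ne hil.symm hjl.symm]
    ring
  funext b a
  have := key 1 b a
  rwa [one_mul, one_mul] at this

end Dyn

/-! ### The action of the braid monoid -/

section Braid

variable (P : EllipticParams) {n m : ℕ}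

lemma legFst_ne_legSnd (i : Fin (m - 1)) : legFst i ≠ legSnd i := by
  simp [legFst, legSnd, Fin.ext_iff]

lemma legSnd_eq_legFst {i j : Fin (m - 1)} (h : (i : ℕ) + 1 = j) : legSnd i = legFst j :=
  Fin.ext h

lemma hGe_comp_perm (k : ℕ) (σ : Equiv.Perm (Fin m)) (hσ : ∀ l : Fin m, k ≤ (σ l : ℕ) ↔ k ≤ l) :
    (hGe k : Fin m → ℤ) ∘ σ = hGe k := by
  funext l
  simp only [hGe, Function.comp_apply, hσ]

lemma le_sigma_iff {i : Fin (m - 1)} {k : ℕ} (h : k ≠ i + 1) (l : Fin m) :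
    k ≤ (sigma i l : ℕ) ↔ k ≤ l := by
  rw [sigma, Equiv.swap_apply_def]
  split_ifs with h1 h2
  · subst h1
    simp only [legFst, legSnd]
    omega
  · subst h2
    simp only [legFst, legSnd]
    omega
  · rfl

lemma hGe_comp_sigma {i : Fin (m - 1)} {k : ℕ} (h : k ≠ i + 1) :
    (hGe k : Fin m → ℤ) ∘ sigma i = hGe k :=
  hGe_comp_perm k _ (le_sigma_iff h)

lemma sigma_inv (i : Fin (m - 1)) : (sigma i)⁻¹ = sigma i := Equiv.swap_inv _ _

lemma sigma_legFst (i : Fin (m - 1)) : sigma i (legFst i) = legSnd i := Equiv.swap_apply_left _ _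

lemma sigma_legSnd (i : Fin (m - 1)) : sigma i (legSnd i) = legFst i := Equiv.swap_apply_right _ _

lemma permDyn_cherGen (σ : Equiv.Perm (Fin m)) (i : Fin (m - 1)) (z : Fin m → ℂˣ) :
    permDyn σ (cherGen P i (z ∘ σ) : DynOp n m) =
      shift (-(hGe (i + 2) ∘ ⇑σ⁻¹))
        (legR P (σ (legFst i)) (σ (legSnd i)) (z (σ (legFst i)) / z (σ (legSnd i)))) := by
  rw [cherGen, permDyn_shift, permDyn_legR]
  rfl

lemma cherWord_far_of_lt {i j : Fin (m - 1)} (h : (i : ℕ) + 1 < j) (z : Fin m → ℂˣ) :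
    (cherWord P [i, j] z : DynOp n m) = cherWord P [j, i] z := by
  have h1 : ∀ k : Fin m, (k : ℕ) ≠ i → (k : ℕ) ≠ i + 1 → sigma i k = k := fun k h1 h2 =>
    Equiv.swap_apply_of_ne_of_ne (fun H => h1 (congrArg Fin.val H))
      (fun H => h2 (congrArg Fin.val H))
  have h2 : ∀ k : Fin m, (k : ℕ) ≠ j → (k : ℕ) ≠ j + 1 → sigma j k = k := fun k h1 h2 =>
    Equiv.swap_apply_of_ne_of_ne (fun H => h1 (congrArg Fin.val H))
      (fun H => h2 (congrArg Fin.val H))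
  simp only [cherWord, permDyn_one, mul_one, permDyn_cherGen, sigma_inv]
  rw [hGe_comp_sigma (by omega), hGe_comp_sigma (by omega),
    h1 (legFst j) (by simp [legFst]; omega) (by simp [legFst]; omega),
    h1 (legSnd j) (by simp [legSnd]; omega) (by simp [legSnd]; omega),
    h2 (legFst i) (by simp [legFst]; omega) (by simp [legFst]; omega),
    h2 (legSnd i) (by simp [legSnd]; omega) (by simp [legSnd]; omega)]
  refine shift_legR_commute P (legFst_ne_legSnd i) (legFst_ne_legSnd j) ?_ ?_ ?_ ?_ ?_ ?_ _ _
  iterate 4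
    · simp [legFst, legSnd, Fin.ext_iff]
      omega
  · have e1 : (i : ℕ) + 2 ≤ j := h
    have e2 : (i : ℕ) + 2 ≤ j + 1 := by omega
    simp [hGe, legFst, legSnd, e1, e2]
  · have e1 : ¬ (j : ℕ) + 2 ≤ i := by omega
    have e2 : ¬ (j : ℕ) + 2 ≤ i + 1 := by omega
    simp [hGe, legFst, legSnd, e1, e2]

/-- The dynamical Yang–Baxter equation, shifted in legs not affected by it. -/
lemma dynamical_yangBaxter_shift {p r s : Fin m} (hpr : p ≠ r) (hps : p ≠ s) (hrs : r ≠ s)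
    {c : Fin m → ℤ} (hcr : c r = c p) (hcs : c s = c p) (u v : ℂˣ) :
    (shift (-(c + Pi.single s 1)) (legR P p r u) * shift (-c) (legR P p s (u * v)) *
        shift (-(c + Pi.single p 1)) (legR P r s v) : DynOp n m) =
      shift (-c) (legR P r s v) * shift (-(c + Pi.single r 1)) (legR P p s (u * v)) *
        shift (-c) (legR P p r u) := by
  have h1 : ∀ u, PreservesWeight (-c) (legR P p r u : DynOp n m) :=
    preservesWeight_legR P (congrArg Neg.neg hcr.symm)
  have h2 : ∀ u, PreservesWeight (-c) (legR P p s u : DynOp n m) :=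
    preservesWeight_legR P (congrArg Neg.neg hcs.symm)
  have h3 : ∀ u, PreservesWeight (-c) (legR P r s u : DynOp n m) :=
    preservesWeight_legR P (congrArg Neg.neg (hcr.trans hcs.symm))
  have key := congrArg (shift (-c)) (dynamical_yangBaxter P (n := n) hpr hps hrs u v)
  rw [shift_mul _ ((h3 _).shift _), shift_mul _ (h2 _), shift_mul _ (h1 _),
    shift_mul _ ((h2 _).shift _), shift_shift, shift_shift, shift_shift] at key
  rw [neg_add, neg_add, neg_add]
  exact key

lemma sigma_braid_apply {i j : Fin (m - 1)} (h : (i : ℕ) + 1 = j) :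
    sigma i (legSnd j) = legSnd j ∧ sigma j (legFst i) = legFst i := by
  constructor
  · refine Equiv.swap_apply_of_ne_of_ne ?_ ?_ <;> simp [legFst, legSnd, Fin.ext_iff] <;> omega
  · refine Equiv.swap_apply_of_ne_of_ne ?_ ?_ <;> simp [legFst, legSnd, Fin.ext_iff] <;> omega

lemma single_comp_perm (σ : Equiv.Perm (Fin m)) (k : Fin m) :
    (Pi.single k 1 : Fin m → ℤ) ∘ σ = Pi.single (σ⁻¹ k) 1 := by
  funext l
  simp [Pi.single_apply, Equiv.eq_symm_apply]

lemma hGe_eq_add_single {i j : Fin (m - 1)} (h : (i : ℕ) + 1 = j) :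
    (hGe ((i : ℕ) + 2) : Fin m → ℤ) = hGe ((j : ℕ) + 2) + Pi.single (legSnd j) 1 := by
  funext l
  have e : l = legSnd j ↔ (l : ℕ) = j + 1 := by rw [Fin.ext_iff]; rfl
  simp only [hGe, Pi.add_apply, Pi.single_apply, e]
  split_ifs <;> omega

lemma cherWord_triple (i j k : Fin (m - 1)) (z : Fin m → ℂˣ) :
    (cherWord P [i, j, k] z : DynOp n m) = cherGen P i z *
      permDyn (sigma i) (cherGen P j (z ∘ sigma i)) *
      permDyn (sigma i * sigma j) (cherGen P k (z ∘ ⇑(sigma i * sigma j))) := by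
  rw [cherWord, cherWord, cherWord, cherWord, permDyn_one, mul_one, permDyn_mul, permDyn_permDyn,
    mul_assoc]
  rfl

lemma cherWord_braid {i j : Fin (m - 1)} (h : (i : ℕ) + 1 = j) (z : Fin m → ℂˣ) :
    (cherWord P [i, j, i] z : DynOp n m) = cherWord P [j, i, j] z := by
  have hr := legSnd_eq_legFst h
  have hpr : legFst i ≠ legFst j := hr ▸ legFst_ne_legSnd i
  have hrs : legFst j ≠ legSnd j := legFst_ne_legSnd j
  have hps : legFst i ≠ legSnd j := by
    simp only [legFst, legSnd, ne_eq, Fin.ext_iff]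
    omega
  have i1 : sigma i (legFst i) = legFst j := by rw [sigma_legFst, hr]
  have i2 : sigma i (legFst j) = legFst i := by rw [← hr, sigma_legSnd]
  obtain ⟨i3, j1⟩ := sigma_braid_apply h
  have j2 := sigma_legFst j
  have j3 := sigma_legSnd j
  have hS := hGe_eq_add_single h
  have hSi : (hGe ((j : ℕ) + 2) : Fin m → ℤ) ∘ sigma i = hGe ((j : ℕ) + 2) :=
    hGe_comp_sigma (by omega)
  have hSj : (hGe ((j : ℕ) + 2) : Fin m → ℤ) ∘ sigma j = hGe ((j : ℕ) + 2) :=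
    hGe_comp_sigma (by omega)
  have hcomp : ∀ (f g : Fin m → ℤ) (σ : Equiv.Perm (Fin m)), (f + g) ∘ σ = f ∘ σ + g ∘ σ :=
    fun f g σ => rfl
  have key := dynamical_yangBaxter_shift P (n := n) hpr hps hrs (c := hGe ((j : ℕ) + 2))
    (by rw [hGe, hGe, if_neg, if_neg] <;> simp only [legFst] <;> omega)
    (by rw [hGe, hGe, if_neg, if_neg] <;> simp only [legFst, legSnd] <;> omega)
    (z (legFst i) / z (legFst j)) (z (legFst j) / z (legSnd j))
  rw [div_mul_div_cancel] at key
  rw [cherWord_triple, cherWord_triple, permDyn_cherGen, permDyn_cherGen, permDyn_cherGen,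
    permDyn_cherGen, cherGen, cherGen]
  simp only [hr, hS, sigma_inv, mul_inv_rev, Equiv.Perm.coe_mul, ← Function.comp_assoc, hcomp,
    hSi, hSj, single_comp_perm, Function.comp_apply, i1, i2, i3, j1, j2, j3]
  exact key

lemma sigma_braid {i j : Fin (m - 1)} (h : (i : ℕ) + 1 = j) :
    sigma i * sigma j * sigma i = sigma j * sigma i * sigma j := by
  have h1 : legFst i ≠ legSnd j := by
    simp [legFst, legSnd, Fin.ext_iff]
    omega
  have h2 := legFst_ne_legSnd i
  have h3 := legFst_ne_legSnd j
  rw [sigma, sigma, ← legSnd_eq_legFst h] at *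
  rw [Equiv.swap_mul_swap_mul_swap h2 h1, Equiv.swap_comm (legFst i),
    Equiv.swap_comm _ (legSnd j), Equiv.swap_mul_swap_mul_swap h3.symm h1.symm,
    Equiv.swap_comm]

lemma sigma_far {i j : Fin (m - 1)} (h : (i : ℕ) + 1 < j ∨ (j : ℕ) + 1 < i) :
    sigma i * sigma j = sigma j * sigma i := by
  refine (Equiv.Perm.disjoint_swap_swap ?_).commute
  simp [legFst, legSnd, Fin.ext_iff]
  omega

lemma realize_mul (s : Side) (A B : DynOp n m) :
    realize P s (A * B) = realize P s A * realize P s B := by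
  refine LinearMap.ext fun v => funext fun b => ?_
  change ∑ a, moment P n s (∑ x, A b x * B x a) * v a =
    ∑ x, moment P n s (A b x) * ∑ a, moment P n s (B x a) * v a
  simp only [map_sum, map_mul, Finset.sum_mul, Finset.mul_sum, mul_assoc]
  exact Finset.sum_comm

lemma realize_one (s : Side) : realize P s (1 : DynOp n m) = 1 := by
  refine LinearMap.ext fun v => funext fun b => ?_
  change ∑ a, moment P n s ((1 : DynOp n m) b a) * v a = v b
  simp [one_apply, apply_ite]

lemma permOp_realize (s : Side) (σ : Equiv.Perm (Fin m)) (A : DynOp n m) :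
    permOp P n σ * realize P s A * permOp P n σ⁻¹ = realize P s (permDyn σ A) := by
  refine LinearMap.ext fun v => funext fun b => ?_
  change ∑ a, moment P n s (A (b ∘ σ) a) * v (a ∘ ⇑σ⁻¹) =
    ∑ a, moment P n s (A (b ∘ σ) (a ∘ σ)) * v a
  rw [← Equiv.sum_comp (σ.symm.arrowCongr (Equiv.refl (Fin n)))]
  refine Finset.sum_congr rfl fun a _ => ?_
  have : (a ∘ σ) ∘ ⇑σ⁻¹ = a := by
    funext k
    simp
  change moment P n s (A (b ∘ σ) (a ∘ σ)) * v ((a ∘ σ) ∘ ⇑σ⁻¹) = _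
  rw [this]

/-- The operator `C_w(λ, z)` or `C_w(ρ, z)` of a braid word, as a function of `z`. -/
def cherOp (n : ℕ) (s : Side) (w : List (Fin (m - 1))) : OpFun P n m :=
  fun z => realize P s (cherWord P w z)

lemma cherOp_nil (s : Side) : cherOp P n s ([] : List (Fin (m - 1))) = 1 :=
  funext fun _ => realize_one P s

lemma cherOp_cons (s : Side) (i : Fin (m - 1)) (w : List (Fin (m - 1))) :
    cherOp P n s (i :: w) = cherOp P n s [i] * sigma i • cherOp P n s w := by
  funext z
  change realize P s (cherGen P i z * permDyn (sigma i) (cherWord P w (z ∘ sigma i))) =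
    realize P s (cherGen P i z * permDyn (sigma i) 1) *
      (permOp P n (sigma i) * realize P s (cherWord P w (z ∘ sigma i)) * permOp P n (sigma i)⁻¹)
  rw [permOp_realize, ← realize_mul, permDyn_one, mul_one]

/-- The product in the skew group algebra of the generators along a braid word. -/
lemma lift_single_cherOp (s : Side) (w : FreeMonoid (Fin (m - 1))) :
    FreeMonoid.lift (fun i : Fin (m - 1) =>
        (SkewMonoidAlgebra.single (sigma i) (cherOp P n s [i]) : SkewAlg P n m)) w =
      SkewMonoidAlgebra.single (permWord w) (cherOp P n s w.toList) := by
  induction w using FreeMonoid.inductionOn' with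
  | one =>
    rw [map_one, permWord, map_one, SkewMonoidAlgebra.one_def, FreeMonoid.toList_one, cherOp_nil]
  | of_mul i w ih =>
    rw [map_mul, ih, FreeMonoid.lift_eval_of, SkewMonoidAlgebra.single_mul_single, permWord,
      permWord, map_mul, FreeMonoid.lift_eval_of, FreeMonoid.toList_of_mul, ← cherOp_cons]

/-- The generators satisfy the braid relations in the skew group algebra. -/
theorem exists_braid_hom (s : Side) : ∃ W : BraidMonoid m →* SkewAlg P n m,
    (∀ i : Fin (m - 1), W (PresentedMonoid.of (BraidRel m) i) =
      SkewMonoidAlgebra.single (sigma i) (cherOp P n s [i])) ∧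
    (∀ w : FreeMonoid (Fin (m - 1)), W (PresentedMonoid.mk (BraidRel m) w) =
      SkewMonoidAlgebra.single (permWord w) (cherOp P n s w.toList)) := by
  refine ⟨PresentedMonoid.lift _ fun w w' h => ?_, fun i => PresentedMonoid.lift_of _ _,
    fun w => lift_single_cherOp P s w⟩
  have hop : cherOp P n s w.toList = cherOp P n s w'.toList := by
    funext z
    refine congrArg (realize P s) ?_
    cases h with
    | braid i j h => exact cherWord_braid P h z
    | far i j h =>
      rcases h with h | h
      · exact cherWord_far_of_lt P h z
      · exact (cherWord_far_of_lt P h z).symm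
  have hperm : permWord w = permWord w' := by
    cases h with
    | braid i j h => simpa [permWord] using sigma_braid h
    | far i j h => simpa [permWord] using sigma_far h
  rw [lift_single_cherOp, lift_single_cherOp, hop, hperm]

lemma cherOp_singleton (s : Side) (i : Fin (m - 1)) (z : Fin m → ℂˣ) :
    cherOp P n s [i] z = realize P s (cherGen P i z) := by
  change realize P s (cherGen P i z * permDyn (sigma i) 1) = _
  rw [permDyn_one, mul_one]

end Braid

/-! ### Moving R-matrices past the operators `L^k(z)` -/

section Passing

variable (P : EllipticParams) {n m : ℕ}

/-- The weight by which the moment map of the given side is translated when it passes `e_ij(z)`. -/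
def sideWeight (s : Side) (i j : Fin n) : CartanDual n :=
  match s with
  | .lam => omega i
  | .rho => omega j

lemma moment_mul_eGen (s : Side) (f : Mero (CartanDual n)) (i j : Fin n) (z : ℂˣ) :
    moment P n s f * eGen P i j z = eGen P i j z * moment P n s (T (sideWeight s i j) f) := by
  cases s with
  | lam =>
    have := FellM.mk_rel (Rel.l_e (P := P) f i j z)
    rwa [map_mul, map_mul] at this
  | rho =>
    have := FellM.mk_rel (Rel.r_e (P := P) f i j z)
    rwa [map_mul, map_mul] at this

lemma sum_update_eq {M : Type*} [AddCommMonoid M] (k : Fin m) (x y : Fin n) (f : Idx n m → M) :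
    ∑ a : Idx n m, (if a k = x then f (Function.update a k y) else 0) =
      ∑ a : Idx n m, if a k = y then f a else 0 := by
  rw [← Finset.sum_filter, ← Finset.sum_filter]
  refine Finset.sum_nbij' (fun a => Function.update a k y) (fun a => Function.update a k x)
    ?_ ?_ ?_ ?_ ?_
  · simp
  · simp
  · intro a ha
    simp [← (Finset.mem_filter.1 ha).2]
  · intro a ha
    simp [← (Finset.mem_filter.1 ha).2]
  · simp

/-- The operator `A` on `V^{⊗ m}` does not act on the tensor factor `k`. -/
def TrivialAt (k : Fin m) (A : DynOp n m) : Prop :=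
  (∀ b a, b k ≠ a k → A b a = 0) ∧
    ∀ b a x, b k = a k → A (Function.update b k x) (Function.update a k x) = A b a

lemma trivialAt_legR {i j k : Fin m} (hi : k ≠ i) (hj : k ≠ j) (z : ℂˣ) :
    TrivialAt k (legR P i j z : DynOp n m) := by
  refine ⟨fun b a h => if_neg fun H => h (H k hi hj), fun b a x h => ?_⟩
  simp only [legR, Function.update_of_ne hi.symm, Function.update_of_ne hj.symm]
  congr 1
  refine propext ⟨fun H l h1 h2 => ?_, fun H l h1 h2 => ?_⟩
  · rcases eq_or_ne l k with rfl | hl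
    · exact h
    · simpa [hl] using H l h1 h2
  · rcases eq_or_ne l k with rfl | hl
    · simp
    · simpa [hl] using H l h1 h2

/-- An operator `A(λ + α)` or `A(ρ + α)`, where the shift `α` depends on the basis vector, passes
`L^k(z)` if `A` does not act on the factor `k`.  The shift changes by the weight of that factor
after, respectively before, the action of `L^k(z)`. -/
lemma realize_mul_Lop {k : Fin m} {A : DynOp n m} (hA : TrivialAt k A) (s : Side)
    (α β : Idx n m → CartanDual n)
    (h : ∀ a y, sideWeight s (a k) y + α a = β (Function.update a k y)) (z : ℂˣ) :
    realize P s (fun b a => T (α a) (A b a)) * Lop P k z =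
      Lop P k z * realize P s (fun b a => T (β a) (A b a)) := by
  refine LinearMap.ext fun v => funext fun b => ?_
  change ∑ a, moment P n s (T (α a) (A b a)) * ∑ y, eGen P (a k) y z * v (Function.update a k y) =
    ∑ y, eGen P (b k) y z * ∑ a, moment P n s (T (β a) (A (Function.update b k y) a)) * v a
  simp only [Finset.mul_sum]
  rw [Finset.sum_comm]
  refine Finset.sum_congr rfl fun y _ => ?_
  have hr : ∀ a : Idx n m,
      eGen P (b k) y z * (moment P n s (T (β a) (A (Function.update b k y) a)) * v a) =
      if a k = y then
        eGen P (b k) y z * (moment P n s (T (β a) (A (Function.update b k y) a)) * v a) else 0 := by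
    intro a
    split_ifs with ha
    · rfl
    · rw [hA.1 _ a (by rw [Function.update_self]; exact Ne.symm ha), map_zero, map_zero, zero_mul,
        mul_zero]
  rw [Finset.sum_congr rfl fun a _ => hr a, ← sum_update_eq k (b k) y]
  refine Finset.sum_congr rfl fun a _ => ?_
  split_ifs with ha
  · rw [← mul_assoc, moment_mul_eGen, T_T, h, ← ha, hA.2 b a y ha.symm, mul_assoc]
  · rw [hA.1 b a (Ne.symm ha), map_zero, map_zero, zero_mul]

lemma sum_add_single_smul (c : Fin m → ℤ) (k : Fin m) (a : Idx n m) :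
    ∑ l, (c + Pi.single k 1 : Fin m → ℤ) l • (omega (a l) : CartanDual n) =
      omega (a k) + ∑ l, c l • omega (a l) := by
  simp [add_zsmul, Finset.sum_add_distrib, Pi.single_apply, add_comm]

lemma realize_lam_shift_mul_Lop {k : Fin m} {A : DynOp n m} (hA : TrivialAt k A)
    {c : Fin m → ℤ} (hc : c k = 0) (z : ℂˣ) :
    realize P Side.lam (shift (c - Pi.single k 1) A) * Lop P k z =
      Lop P k z * realize P Side.lam (shift c A) := by
  refine realize_mul_Lop P hA Side.lam _ _ (fun a y => ?_) z
  rw [sideWeight, ← sum_add_single_smul, sub_add_cancel]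
  refine Finset.sum_congr rfl fun l _ => ?_
  rcases eq_or_ne l k with rfl | hl
  · simp [hc]
  · rw [Function.update_of_ne hl]

lemma realize_rho_shift_mul_Lop {k : Fin m} {A : DynOp n m} (hA : TrivialAt k A)
    {c : Fin m → ℤ} (hc : c k = 0) (z : ℂˣ) :
    realize P Side.rho (shift c A) * Lop P k z =
      Lop P k z * realize P Side.rho (shift (c + Pi.single k 1) A) := by
  refine realize_mul_Lop P hA Side.rho _ _ (fun a y => ?_) z
  rw [sum_add_single_smul, sideWeight, Function.update_self]
  refine congrArg _ (Finset.sum_congr rfl fun l _ => ?_)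
  rcases eq_or_ne l k with rfl | hl
  · simp [hc]
  · rw [Function.update_of_ne hl]

end Passing

/-! ### The RLL relation in two legs -/

section RLL

variable (P : EllipticParams) {n m : ℕ}

/-- The defining relation of `F_ell(M(n))` for the regularized R-matrix. -/
lemma rll_regR (a b c d : Fin n) (z₁ z₂ : ℂˣ) :
    ∑ x, ∑ y, moment P n .lam (regR P a c x y (z₁ / z₂)) * eGen P x b z₁ * eGen P y d z₂ =
      ∑ x, ∑ y, moment P n .rho (regR P x y b d (z₁ / z₂)) * eGen P c y z₂ * eGen P a x z₁ := by
  have hφ : MeromorphicOn (fun w => theta P ((P.q : ℂ) ^ 2 * w)) {0}ᶜ := fun w hw =>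
    ((analyticAt_theta P (mul_ne_zero (pow_ne_zero 2 (q_ne_zero P)) hw)).comp_of_eq
      (analyticAt_const.mul analyticAt_id) rfl).meromorphicAt
  have := FellM.mk_rel (Rel.rll a b c d z₁ z₂ _ hφ _ _
    (fun x y => isSpecLimit_regR P a c x y (z₁ / z₂))
    (fun x y => isSpecLimit_regR P x y b d (z₁ / z₂)))
  simp only [map_sum, map_mul] at this
  exact this

lemma regR_eq_zero {x y a b : Fin n} (h1 : ¬ (x = a ∧ y = b)) (h2 : ¬ (x = b ∧ y = a)) (z : ℂˣ) :
    regR P x y a b z = 0 := by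
  refine Represents.eq (F := regRcoef P x y a b (z : ℂ)) (G := fun _ => 0) ⟨_, rfl⟩
    ⟨IsMero.of_analytic fun _ => analyticAt_const, rfl⟩ (Eventually.of_forall fun ζ => ?_)
  rw [regRcoef]
  split_ifs with h3 h4
  · exact absurd (h3 ▸ h4) h1
  · rfl
  · rfl

/-- The R-matrix has weight zero, so that its source and its target have the same total weight. -/
lemma T_regR (x y a b : Fin n) (z : ℂˣ) :
    T (omega x + omega y) (regR P x y a b z) = T (omega a + omega b) (regR P x y a b z) := by
  by_cases h1 : x = a ∧ y = b
  · rw [h1.1, h1.2]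
  by_cases h2 : x = b ∧ y = a
  · rw [h2.1, h2.2, add_comm]
  · rw [regR_eq_zero P h1 h2, map_zero, map_zero]

/-- The sum over all labels that agree with `b` outside of the positions `i` and `j`. -/
lemma sum_two_legs {M : Type*} [AddCommMonoid M] {i j : Fin m} (hij : i ≠ j) (b : Idx n m)
    (F : Idx n m → M) :
    ∑ a : Idx n m, (if ∀ k, k ≠ i → k ≠ j → b k = a k then F a else 0) =
      ∑ x, ∑ y, F (Function.update (Function.update b i x) j y) := by
  rw [← Finset.sum_filter, ← Fintype.sum_prod_type'
    (f := fun x y => F (Function.update (Function.update b i x) j y))]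
  have hinv : ∀ a : Idx n m, (∀ k, k ≠ i → k ≠ j → b k = a k) →
      Function.update (Function.update b i (a i)) j (a j) = a := by
    intro a ha
    funext k
    by_cases hj : k = j
    · simp [hj]
    by_cases hi : k = i
    · simp [hi, hij]
    · simp [hi, hj, ha k hi hj]
  refine Finset.sum_nbij' (fun a => (a i, a j))
    (fun x => Function.update (Function.update b i x.1) j x.2) ?_ ?_ ?_ ?_ ?_
  · simp
  · intro x _
    refine Finset.mem_filter.2 ⟨Finset.mem_univ _, fun k hi hj => ?_⟩
    simp [hi, hj]
  · intro a ha
    exact hinv a (Finset.mem_filter.1 ha).2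
  · intro x _
    simp [hij]
  · intro a ha
    rw [hinv a (Finset.mem_filter.1 ha).2]

lemma realize_shift_single_add_single (s : Side) (i j : Fin m) (A : DynOp n m) :
    realize P s (shift (Pi.single i 1 + Pi.single j 1) A) =
      realize P s (fun b a => T (omega (a i) + omega (a j) : CartanDual n) (A b a)) := by
  refine congrArg _ (funext fun b => funext fun a => ?_)
  rw [shift, sum_add_single_smul]
  simp [Pi.single_apply, add_comm]

/-- The RLL relation in the legs `i` and `j`. -/
lemma realize_legR_mul_Lop_mul_Lop {i j : Fin m} (hij : i ≠ j) (z₁ z₂ : ℂˣ) :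
    realize P Side.lam (legR P i j (z₁ / z₂) : DynOp n m) * (Lop P i z₁ * Lop P j z₂) =
      Lop P j z₂ * Lop P i z₁ *
        realize P Side.rho (shift (Pi.single i 1 + Pi.single j 1) (legR P i j (z₁ / z₂))) := by
  obtain ⟨M, hM⟩ : ∃ M : Idx n m → Idx n m → Mero (CartanDual n),
      (legR P i j (z₁ / z₂) : DynOp n m) = (show DynOp n m from M) :=
    ⟨_, rfl⟩
  have hM' : ∀ b a, M b a = if ∀ k, k ≠ i → k ≠ j → b k = a k then
      regR P (b i) (b j) (a i) (a j) (z₁ / z₂) else 0 := fun b a => by rw [← legR, hM]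
  rw [hM]
  rw [realize_shift_single_add_single]
  refine LinearMap.ext fun v => funext fun b => ?_
  change ∑ a : Idx n m, moment P n .lam (M b a) *
      ∑ p, eGen P (a i) p z₁ * ∑ r, eGen P (Function.update a i p j) r z₂ *
        v (Function.update (Function.update a i p) j r) =
    ∑ y, eGen P (b j) y z₂ * ∑ x, eGen P (Function.update b j y i) x z₁ *
      ∑ a : Idx n m, moment P n .rho (T (omega (a i) + omega (a j) : CartanDual n)
        (M (Function.update (Function.update b j y) i x) a)) * v a
  have hl : ∀ (s : Side) (b : Idx n m) (α : Idx n m → CartanDual n)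
      (F : Idx n m → FellM P n),
      ∑ a, moment P n s (T (α a) (M b a)) * F a =
        ∑ p, ∑ r, moment P n s (T (α (Function.update (Function.update b i p) j r))
          (regR P (b i) (b j) p r (z₁ / z₂))) *
          F (Function.update (Function.update b i p) j r) := by
    intro s b α F
    have := sum_two_legs hij b fun a => moment P n s (T (α a)
      (regR P (b i) (b j) (a i) (a j) (z₁ / z₂))) * F a
    simp only [Function.update_self, Function.update_of_ne hij] at this
    rw [← this]
    refine Finset.sum_congr rfl fun a _ => ?_
    rw [hM']
    split_ifs
    · rfl
    · rw [map_zero, map_zero, zero_mul]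
  have hl0 := hl .lam b 0 fun a => ∑ p, eGen P (a i) p z₁ *
    ∑ r, eGen P (Function.update a i p j) r z₂ * v (Function.update (Function.update a i p) j r)
  simp only [Pi.zero_apply, T_zero] at hl0
  rw [hl0]
  have hl1 := fun b => hl .rho b (fun a => omega (a i) + omega (a j)) v
  simp only [hl1]
  have u1 : ∀ (x y p r : Fin n),
      Function.update (Function.update (Function.update (Function.update b j y) i x) i p) j r =
        Function.update (Function.update b i p) j r := by
    intro x y p r
    funext k
    simp only [Function.update_apply]
    split_ifs <;> rfl
  have u2 : ∀ (x y p r : Fin n),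
      Function.update (Function.update (Function.update (Function.update b i x) j y) i p) j r =
        Function.update (Function.update b i p) j r := by
    intro x y p r
    funext k
    simp only [Function.update_apply]
    split_ifs <;> rfl
  simp only [u1, u2, Function.update_self, Function.update_of_ne hij,
    Function.update_of_ne hij.symm]
  simp only [Finset.mul_sum]
  have e1 : ∀ F : Fin n → Fin n → Fin n → Fin n → FellM P n,
      ∑ x, ∑ y, ∑ p, ∑ r, F x y p r = ∑ p, ∑ r, ∑ x, ∑ y, F x y p r := by
    intro F
    simp only [← Fintype.sum_prod_type']
    rw [← Equiv.sum_comp ((Equiv.prodAssoc _ _ _).symm.trans ((Equiv.prodComm _ _).trans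
      (Equiv.prodAssoc _ _ _)))]
    rfl
  have e2 : ∀ F : Fin n → Fin n → Fin n → Fin n → FellM P n,
      ∑ y, ∑ x, ∑ p, ∑ r, F y x p r = ∑ p, ∑ r, ∑ x, ∑ y, F y x p r := by
    intro F
    rw [Finset.sum_comm]
    exact e1 fun x y => F y x
  refine (e1 _).trans (Eq.trans ?_ (e2 _).symm)
  refine Finset.sum_congr rfl fun p _ => Finset.sum_congr rfl fun r _ => ?_
  have h := congrArg (· * v (Function.update (Function.update b i p) j r))
    (rll_regR P (b i) p (b j) r z₁ z₂)
  simp only [Finset.sum_mul, mul_assoc] at h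
  refine h.trans ?_
  refine Finset.sum_congr rfl fun x _ => Finset.sum_congr rfl fun y _ => ?_
  rw [← T_regR]
  rw [← mul_assoc, moment_mul_eGen, mul_assoc, ← mul_assoc (moment P n _ _), moment_mul_eGen, T_T,
    mul_assoc]
  rfl

end RLL

/-! ### Products of L-operators along a list of legs -/

section ListProducts

variable (P : EllipticParams) {n m : ℕ}

/-- The product `L^{k_1}(z_{k_1}) L^{k_2}(z_{k_2}) ⋯` along a list of legs `k_1, k_2, …`, as a
function of `z`. -/
def LopList (n : ℕ) (ks : List (Fin m)) : OpFun P n m :=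
  fun z => (ks.map fun k => Lop P k (z k)).prod

lemma LopList_nil (z : Fin m → ℂˣ) : LopList P n ([] : List (Fin m)) z = 1 := rfl

lemma LopList_cons (k : Fin m) (ks : List (Fin m)) (z : Fin m → ℂˣ) :
    LopList P n (k :: ks) z = Lop P k (z k) * LopList P n ks z := by
  rw [LopList, List.map_cons, List.prod_cons]
  rfl

lemma LopList_append (ks ls : List (Fin m)) (z : Fin m → ℂˣ) :
    LopList P n (ks ++ ls) z = LopList P n ks z * LopList P n ls z := by
  rw [LopList, List.map_append, List.prod_append]
  rfl

/-- The coefficients of the dynamical shift `h^{k_1} + h^{k_2} + ⋯`. -/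
def legCount (ks : List (Fin m)) : Fin m → ℤ := fun k => (ks.count k : ℤ)

lemma legCount_cons (k : Fin m) (ks : List (Fin m)) :
    legCount (k :: ks) = legCount ks + Pi.single k 1 := by
  funext l
  simp only [legCount, List.count_cons, Pi.add_apply, Pi.single_apply, beq_iff_eq, Nat.cast_add,
    Nat.cast_ite, Nat.cast_one, Nat.cast_zero, eq_comm (a := k)]

lemma legCount_of_notMem {ks : List (Fin m)} {k : Fin m} (h : k ∉ ks) : legCount ks k = 0 := by
  rw [legCount, List.count_eq_zero_of_not_mem h, Nat.cast_zero]

lemma legCount_of_mem {ks : List (Fin m)} (hks : ks.Nodup) {k : Fin m} (h : k ∈ ks) :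
    legCount ks k = 1 := by
  rw [legCount, List.count_eq_one_of_mem hks h, Nat.cast_one]

lemma realize_lam_shift_mul_LopList {ks : List (Fin m)} (hks : ks.Nodup) {A : DynOp n m}
    {c : Fin m → ℤ} (hA : ∀ k ∈ ks, TrivialAt k A ∧ c k = 0) (z : Fin m → ℂˣ) :
    realize P Side.lam (shift (c - legCount ks) A) * LopList P n ks z =
      LopList P n ks z * realize P Side.lam (shift c A) := by
  induction ks with
  | nil =>
    have : (legCount [] : Fin m → ℤ) = 0 := rfl
    rw [LopList_nil, one_mul, mul_one, this, sub_zero]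
  | cons k ks ih =>
    obtain ⟨hk, hks⟩ := List.nodup_cons.1 hks
    obtain ⟨hA1, hA2⟩ := List.forall_mem_cons.1 hA
    rw [LopList_cons, ← mul_assoc, legCount_cons, ← sub_sub,
      realize_lam_shift_mul_Lop P hA1.1 (by simp [hA1.2, legCount_of_notMem hk]), mul_assoc,
      ih hks hA2, mul_assoc]

lemma realize_rho_shift_mul_LopList {ks : List (Fin m)} (hks : ks.Nodup) {A : DynOp n m}
    {c : Fin m → ℤ} (hA : ∀ k ∈ ks, TrivialAt k A ∧ c k = 0) (z : Fin m → ℂˣ) :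
    realize P Side.rho (shift c A) * LopList P n ks z =
      LopList P n ks z * realize P Side.rho (shift (c + legCount ks) A) := by
  induction ks generalizing c with
  | nil =>
    have : (legCount [] : Fin m → ℤ) = 0 := rfl
    rw [LopList_nil, one_mul, mul_one, this, add_zero]
  | cons k ks ih =>
    obtain ⟨hk, hks⟩ := List.nodup_cons.1 hks
    obtain ⟨hA1, hA2⟩ := List.forall_mem_cons.1 hA
    have hA3 : ∀ l ∈ ks, TrivialAt l A ∧ (c + Pi.single k 1 : Fin m → ℤ) l = 0 := fun l hl => by
      refine ⟨(hA2 l hl).1, ?_⟩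
      have hlk : l ≠ k := fun H => hk (H ▸ hl)
      rw [Pi.add_apply, (hA2 l hl).2, Pi.single_eq_of_ne hlk, add_zero]
    rw [LopList_cons, ← mul_assoc, realize_rho_shift_mul_Lop P hA1.1 hA1.2, mul_assoc,
      ih hks hA3, mul_assoc, legCount_cons, add_assoc, add_comm (legCount ks)]

lemma permOp_Lop (σ : Equiv.Perm (Fin m)) (k : Fin m) (z : ℂˣ) :
    permOp P n σ * Lop P k z * permOp P n σ⁻¹ = Lop P (σ k) z := by
  refine LinearMap.ext fun v => funext fun b => ?_
  change ∑ y, eGen P (b (σ k)) y z * v (Function.update (b ∘ σ) k y ∘ ⇑σ⁻¹) =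
    ∑ y, eGen P (b (σ k)) y z * v (Function.update b (σ k) y)
  refine Finset.sum_congr rfl fun y _ => congrArg (fun a => _ * v a) ?_
  funext l
  by_cases hl : l = σ k
  · subst hl
    simp
  · have : σ⁻¹ l ≠ k := fun H => hl (by simp [← H])
    simp only [Function.comp_apply, Function.update_of_ne hl, Function.update_of_ne this]
    simp

lemma smul_LopList (σ : Equiv.Perm (Fin m)) (ks : List (Fin m)) :
    σ • LopList P n ks = LopList P n (ks.map σ) := by
  funext z
  change permOp P n σ * LopList P n ks (z ∘ σ) * permOp P n σ⁻¹ = _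
  induction ks with
  | nil => rw [LopList_nil, List.map_nil, LopList_nil, mul_one, ← permOp_mul, mul_inv_cancel,
      permOp_one]
  | cons k ks ih =>
    have h : permOp P n σ⁻¹ * permOp P n σ = 1 := by
      rw [← permOp_mul, inv_mul_cancel, permOp_one]
    rw [List.map_cons, LopList_cons, LopList_cons, ← ih, ← permOp_Lop]
    simp only [mul_assoc]
    rw [← mul_assoc (permOp P n σ⁻¹) (permOp P n σ), h, one_mul]
    rfl

end ListProducts

/-! ### The first legs in decreasing order -/

section DescLegs

variable {m : ℕ}

/-- The legs `d - 1, …, 1, 0`. -/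
def descLegs : (d : ℕ) → d ≤ m → List (Fin m)
  | 0, _ => []
  | d + 1, h => ⟨d, h⟩ :: descLegs d (Nat.le_of_succ_le h)

lemma mem_descLegs {d : ℕ} (hd : d ≤ m) {k : Fin m} : k ∈ descLegs d hd ↔ (k : ℕ) < d := by
  induction d with
  | zero => simp [descLegs]
  | succ d ih =>
    rw [descLegs, List.mem_cons, ih, Fin.ext_iff]
    change (k : ℕ) = d ∨ _ ↔ _
    omega

lemma nodup_descLegs {d : ℕ} (hd : d ≤ m) : (descLegs d hd).Nodup := by
  induction d with
  | zero => exact List.nodup_nil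
  | succ d ih =>
    rw [descLegs, List.nodup_cons]
    exact ⟨fun h => lt_irrefl d ((mem_descLegs _).1 h), ih _⟩

lemma exists_descLegs_eq_append {e d : ℕ} (h : e ≤ d) (hd : d ≤ m) :
    ∃ ks : List (Fin m), descLegs d hd = ks ++ descLegs e (h.trans hd) ∧
      ∀ k, k ∈ ks ↔ e ≤ (k : ℕ) ∧ (k : ℕ) < d := by
  induction d, h using Nat.le_induction with
  | base => exact ⟨[], rfl, fun k => by simp⟩
  | succ d h ih =>
    obtain ⟨ks, h1, h2⟩ := ih (Nat.le_of_succ_le hd)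
    refine ⟨⟨d, hd⟩ :: ks, by rw [descLegs, h1, List.cons_append], fun k => ?_⟩
    rw [List.mem_cons, h2, Fin.ext_iff]
    change (k : ℕ) = d ∨ _ ↔ _
    omega

lemma ofFn_castLE {α : Type*} {d : ℕ} (hd : d ≤ m) (f : Fin m → α) :
    List.ofFn (fun k : Fin d => f (Fin.castLE hd k)) = (descLegs d hd).reverse.map f := by
  induction d with
  | zero => rfl
  | succ d ih =>
    rw [List.ofFn_succ', descLegs, List.reverse_cons, List.map_append, ← ih, List.concat_eq_append]
    rfl

lemma Lprod_eq (P : EllipticParams) (n : ℕ) {d : ℕ} (hd : d ≤ m) (z : Fin m → ℂˣ) :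
    Lprod P n d hd z = LopList P n (descLegs d hd).reverse z :=
  congrArg List.prod (ofFn_castLE hd fun k => Lop P k (z k))

lemma LprodRev_eq (P : EllipticParams) (n : ℕ) {d : ℕ} (hd : d ≤ m) (z : Fin m → ℂˣ) :
    LprodRev P n d hd z = LopList P n (descLegs d hd) z := by
  rw [LprodRev, ofFn_castLE hd fun k => Lop P k (z k), List.map_reverse, List.reverse_reverse]
  rfl

lemma sigma_apply_of_ne {i : Fin (m - 1)} {k : Fin m} (h1 : (k : ℕ) ≠ i) (h2 : (k : ℕ) ≠ i + 1) :
    sigma i k = k :=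
  Equiv.swap_apply_of_ne_of_ne (fun H => h1 (congrArg Fin.val H)) (fun H => h2 (congrArg Fin.val H))

lemma map_sigma_eq_self {i : Fin (m - 1)} {ks : List (Fin m)}
    (h : ∀ k ∈ ks, (k : ℕ) ≠ i ∧ (k : ℕ) ≠ i + 1) : ks.map (sigma i) = ks := by
  conv_rhs => rw [← List.map_id ks]
  exact List.map_congr_left fun k hk => sigma_apply_of_ne (h k hk).1 (h k hk).2

lemma prod_map_sigma_apply {w : List (Fin (m - 1))} {k : Fin m}
    (h : ∀ i ∈ w, (k : ℕ) ≠ i ∧ (k : ℕ) ≠ i + 1) : (w.map sigma).prod k = k := by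
  induction w with
  | nil => rfl
  | cons i w ih =>
    obtain ⟨h1, h2⟩ := List.forall_mem_cons.1 h
    rw [List.map_cons, List.prod_cons, Equiv.Perm.mul_apply, ih h2, sigma_apply_of_ne h1.1 h1.2]

/-- The word `s_d ⋯ s_2 s_1` (in the zero-based labels, `d - 1, …, 1, 0`). -/
def cycleWord (m d : ℕ) (h : d ≤ m - 1) : List (Fin (m - 1)) :=
  ((List.finRange d).map (Fin.castLE h)).reverse

lemma cycleWord_succ {d : ℕ} (h : d + 1 ≤ m - 1) :
    cycleWord m (d + 1) h = ⟨d, h⟩ :: cycleWord m d (Nat.le_of_succ_le h) := by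
  rw [cycleWord, List.finRange_succ_last, List.map_append, List.reverse_append, List.map_map]
  rfl

lemma lt_of_mem_cycleWord {d : ℕ} {h : d ≤ m - 1} {i : Fin (m - 1)} (hi : i ∈ cycleWord m d h) :
    (i : ℕ) < d := by
  obtain ⟨k, -, rfl⟩ := List.mem_map.1 (List.mem_reverse.1 hi)
  exact k.2

lemma map_cycleWord_descLegs {d : ℕ} (h : d + 1 ≤ m) :
    (descLegs (d + 1) h).map ((cycleWord m d (Nat.le_sub_one_of_lt h)).map sigma).prod =
      descLegs d (Nat.le_of_succ_le h) ++ [⟨d, h⟩] := by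
  induction d with
  | zero => rfl
  | succ d ih =>
    have hd : d + 1 ≤ m - 1 := Nat.le_sub_one_of_lt h
    have h1 : ((cycleWord m d (Nat.le_of_succ_le hd)).map sigma).prod (⟨d + 1, h⟩ : Fin m) =
        ⟨d + 1, h⟩ := prod_map_sigma_apply fun i hi => by
      have := lt_of_mem_cycleWord hi
      constructor <;> simp only <;> omega
    have h2 : (descLegs d (Nat.le_of_succ_le (Nat.le_of_succ_le h))).map
        (sigma (⟨d, hd⟩ : Fin (m - 1))) = descLegs d _ := map_sigma_eq_self fun k hk => by
      have := (mem_descLegs _).1 hk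
      constructor <;> simp only <;> omega
    rw [cycleWord_succ hd, List.map_cons, List.prod_cons, Equiv.Perm.coe_mul, ← List.map_map,
      descLegs, List.map_cons, h1, ih (Nat.le_of_succ_le h), List.map_cons, List.map_append, h2,
      descLegs, List.cons_append, List.map_singleton]
    have e1 : sigma (⟨d, hd⟩ : Fin (m - 1)) (⟨d + 1, h⟩ : Fin m) = ⟨d, Nat.le_of_succ_le h⟩ :=
      sigma_legSnd _
    have e2 : sigma (⟨d, hd⟩ : Fin (m - 1)) (⟨d, Nat.le_of_succ_le h⟩ : Fin m) = ⟨d + 1, h⟩ :=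
      sigma_legFst _
    rw [e1, e2]

lemma tWord_succ {d : ℕ} (h : d + 1 ≤ m) : tWord m (d + 1) h =
    tWord m d (Nat.le_of_succ_le h) ++ cycleWord m d (Nat.le_sub_one_of_lt h) := rfl

lemma add_two_le_of_mem_tWord {d : ℕ} {h : d ≤ m} {i : Fin (m - 1)} (hi : i ∈ tWord m d h) :
    (i : ℕ) + 2 ≤ d := by
  induction d with
  | zero => exact absurd hi List.not_mem_nil
  | succ d ih =>
    rw [tWord_succ, List.mem_append] at hi
    rcases hi with hi | hi
    · exact (ih hi).trans (Nat.le_succ d)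
    · have := lt_of_mem_cycleWord hi
      omega

/-- The permutation of the braid `t_d` reverses the first `d` legs. -/
lemma map_tWord_descLegs {d : ℕ} (h : d ≤ m) :
    (descLegs d h).map ((tWord m d h).map sigma).prod = (descLegs d h).reverse := by
  induction d with
  | zero => rfl
  | succ d ih =>
    have h1 : ((tWord m d (Nat.le_of_succ_le h)).map sigma).prod (⟨d, h⟩ : Fin m) = ⟨d, h⟩ :=
      prod_map_sigma_apply fun i hi => by
        have := add_two_le_of_mem_tWord hi
        constructor <;> simp only <;> omega
    rw [tWord_succ, List.map_append, List.prod_append, Equiv.Perm.coe_mul, ← List.map_map,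
      map_cycleWord_descLegs, List.map_append, ih, List.map_singleton, h1, descLegs,
      List.reverse_cons]

end DescLegs

/-! ### Braid words and products of L-operators -/

section Exchange

variable (P : EllipticParams) {n m : ℕ}

lemma PreservesWeight.cherWord {c : Fin m → ℤ} {w : List (Fin (m - 1))}
    (hc : ∀ i ∈ w, c ∘ sigma i = c) (z : Fin m → ℂˣ) :
    PreservesWeight c (cherWord P w z : DynOp n m) := by
  induction w generalizing z with
  | nil => exact .one c
  | cons i w ih =>
    obtain ⟨h1, h2⟩ := List.forall_mem_cons.1 hc
    refine .mul (.shift (preservesWeight_legR P ?_ _) _) (.permDyn ?_)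
    · have := congrFun h1 (legSnd i)
      rwa [Function.comp_apply, sigma_legSnd] at this
    · rw [h1]
      exact ih h2 _

/-- The operator `C_w(λ + ∑_k c_k h^k, z)`, or the same with `ρ`, as a function of `z`. -/
def shiftedCherOp (n : ℕ) (s : Side) (c : Fin m → ℤ) (w : List (Fin (m - 1))) : OpFun P n m :=
  fun z => realize P s (shift c (cherWord P w z))

lemma shiftedCherOp_nil (s : Side) (c : Fin m → ℤ) :
    shiftedCherOp P n s c ([] : List (Fin (m - 1))) = 1 := by
  funext z
  change realize P s (shift c 1) = 1
  rw [shift_one, realize_one]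

lemma shiftedCherOp_cons (s : Side) {c : Fin m → ℤ} {i : Fin (m - 1)} {w : List (Fin (m - 1))}
    (hi : c ∘ sigma i = c) (hw : ∀ i ∈ w, c ∘ sigma i = c) :
    shiftedCherOp P n s c (i :: w) =
      shiftedCherOp P n s c [i] * sigma i • shiftedCherOp P n s c w := by
  funext z
  change realize P s (shift c (cherGen P i z * permDyn (sigma i) (cherWord P w (z ∘ sigma i)))) =
    realize P s (shift c (cherGen P i z * permDyn (sigma i) 1)) *
      (permOp P n (sigma i) * realize P s (shift c (cherWord P w (z ∘ sigma i))) *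
        permOp P n (sigma i)⁻¹)
  have h : PreservesWeight c (permDyn (sigma i) (cherWord P w (z ∘ sigma i)) : DynOp n m) :=
    .permDyn (by rw [hi]; exact .cherWord P hw _)
  rw [permOp_realize, permDyn_shift, sigma_inv, hi, shift_mul _ h, realize_mul, permDyn_one,
    mul_one]

/-- The relation of a single generator of the braid monoid with the product of L-operators in
the first `d` legs, in decreasing order. -/
lemma shiftedCherOp_singleton_mul_LopList {d : ℕ} (hd : d ≤ m) {i : Fin (m - 1)}
    (hi : (i : ℕ) + 2 ≤ d) :
    shiftedCherOp P n Side.lam (hGe d) [i] * sigma i • LopList P n (descLegs d hd) =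
      LopList P n (descLegs d hd) * shiftedCherOp P n Side.rho (fun _ => 1) [i] := by
  obtain ⟨ks, hks, hmem⟩ := exists_descLegs_eq_append hi hd
  have hi0 : (i : ℕ) ≤ m := by omega
  have hdesc : descLegs ((i : ℕ) + 2) (hi.trans hd) = legSnd i :: legFst i :: descLegs i hi0 := rfl
  rw [hdesc] at hks
  have hnd := nodup_descLegs hd
  rw [hks] at hnd
  have hnd1 : ks.Nodup := hnd.of_append_left
  have hmem0 : ∀ k, k ∈ descLegs (i : ℕ) hi0 ↔ (k : ℕ) < i := fun k => mem_descLegs _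
  have v1 : ((legFst i : Fin m) : ℕ) = i := rfl
  have v2 : ((legSnd i : Fin m) : ℕ) = i + 1 := rfl
  have hmap : (descLegs d hd).map (sigma i) = ks ++ legFst i :: legSnd i :: descLegs i hi0 := by
    rw [hks, List.map_append, List.map_cons, List.map_cons, sigma_legSnd, sigma_legFst,
      map_sigma_eq_self fun k hk => ?_, map_sigma_eq_self fun k hk => ?_]
    · have := (hmem0 k).1 hk
      omega
    · have := (hmem k).1 hk
      omega
  have htriv : ∀ (u : ℂˣ) (k : Fin m), (k : ℕ) ≠ i → (k : ℕ) ≠ i + 1 →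
      TrivialAt k (legR P (legFst i) (legSnd i) u : DynOp n m) := fun u k h1 h2 =>
    trivialAt_legR P (fun H => h1 (congrArg Fin.val H)) (fun H => h2 (congrArg Fin.val H)) u
  -- The shift `h^{≥ d} - h^{≥ i+2}` is minus the weight of the legs to the left of the pair.
  have s1 : hGe d + -hGe ((i : ℕ) + 2) = 0 - legCount ks := by
    funext k
    by_cases hk : k ∈ ks
    · have := (hmem k).1 hk
      simp [hGe, legCount_of_mem hnd1 hk, this.1, this.2]
    · have h1 := mt (hmem k).2 hk
      simp only [Pi.add_apply, Pi.neg_apply, Pi.sub_apply, Pi.zero_apply, hGe,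
        legCount_of_notMem hk]
      split_ifs <;> omega
  -- The shift `h^{≤ m} - h^{≥ i+2}` is the weight of the pair and of the legs to its right.
  have s2 : (fun _ => 1) + -hGe ((i : ℕ) + 2) =
      (Pi.single (legFst i) 1 + Pi.single (legSnd i) 1 + legCount (descLegs (i : ℕ) hi0) :
        Fin m → ℤ) := by
    funext k
    have e1 : k = legFst i ↔ (k : ℕ) = i := Fin.ext_iff
    have e2 : k = legSnd i ↔ (k : ℕ) = i + 1 := Fin.ext_iff
    by_cases hk : k ∈ descLegs (i : ℕ) hi0
    · have h1 := (hmem0 k).1 hk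
      simp only [Pi.add_apply, Pi.neg_apply, hGe, legCount_of_mem (nodup_descLegs _) hk,
        Pi.single_apply, e1, e2]
      split_ifs <;> omega
    · have h1 := mt (hmem0 k).2 hk
      simp only [Pi.add_apply, Pi.neg_apply, hGe, legCount_of_notMem hk, Pi.single_apply, e1, e2]
      split_ifs <;> omega
  rw [smul_LopList, hmap]
  funext z
  have rll := realize_legR_mul_Lop_mul_Lop P (n := n) (legFst_ne_legSnd i) (z (legFst i))
    (z (legSnd i))
  have pass := realize_rho_shift_mul_LopList P (n := n) (nodup_descLegs hi0)
    (A := legR P (legFst i) (legSnd i) (z (legFst i) / z (legSnd i)))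
    (c := Pi.single (legFst i) 1 + Pi.single (legSnd i) 1) (fun k hk => by
      have := (hmem0 k).1 hk
      have e1 : k ≠ legFst i := fun H => by simp [H, v1] at this
      have e2 : k ≠ legSnd i := fun H => by simp [H, v2] at this
      exact ⟨htriv _ k (by omega) (by omega), by simp [e1, e2]⟩) z
  change realize P Side.lam (shift (hGe d) (cherGen P i z * permDyn (sigma i) 1)) *
      LopList P n (ks ++ legFst i :: legSnd i :: descLegs i hi0) z =
    LopList P n (descLegs d hd) z *
      realize P Side.rho (shift (fun _ => 1) (cherGen P i z * permDyn (sigma i) 1))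
  rw [permDyn_one, mul_one, cherGen, shift_shift, shift_shift, s1, s2, hks, LopList_append,
    LopList_append, LopList_cons, LopList_cons, LopList_cons, LopList_cons, ← mul_assoc,
    realize_lam_shift_mul_LopList P hnd1 (c := 0) (fun k hk => ⟨?_, rfl⟩), shift_zero]
  · simp only [mul_assoc]
    rw [← pass, ← mul_assoc (Lop P (legFst i) _), ← mul_assoc (realize P Side.lam _), rll]
    simp only [mul_assoc]
  · have := (hmem k).1 hk
    exact htriv _ k (by omega) (by omega)

/-- The exchange relation for a braid word on the first `d` strands. -/
lemma shiftedCherOp_mul_LopList {d : ℕ} (hd : d ≤ m) {w : List (Fin (m - 1))}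
    (hw : ∀ i ∈ w, (i : ℕ) + 2 ≤ d) :
    shiftedCherOp P n Side.lam (hGe d) w * (w.map sigma).prod • LopList P n (descLegs d hd) =
      LopList P n (descLegs d hd) * shiftedCherOp P n Side.rho (fun _ => 1) w := by
  induction w with
  | nil => rw [shiftedCherOp_nil, shiftedCherOp_nil, List.map_nil, List.prod_nil, one_smul, one_mul,
      mul_one]
  | cons i w ih =>
    obtain ⟨h1, h2⟩ := List.forall_mem_cons.1 hw
    have hc : ∀ j : Fin (m - 1), (j : ℕ) + 2 ≤ d → (hGe d : Fin m → ℤ) ∘ sigma j = hGe d :=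
      fun j hj => hGe_comp_sigma (by omega)
    rw [shiftedCherOp_cons P _ (hc i h1) (fun j hj => hc j (h2 j hj)),
      shiftedCherOp_cons P _ (c := fun _ => 1) rfl (fun j hj => rfl), List.map_cons,
      List.prod_cons, mul_smul, mul_assoc, ← smul_mul', ih h2, smul_mul', ← mul_assoc,
      shiftedCherOp_singleton_mul_LopList P hd h1, mul_assoc]

/-- The exchange relation for the braid `t_d`. -/
theorem realize_tWord_mul_Lprod {d : ℕ} (hd : d ≤ m) (z : Fin m → ℂˣ) :
    realize P Side.lam (shift (hGe d) (cherWord P (tWord m d hd) z)) * Lprod P n d hd z =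
      LprodRev P n d hd z *
        realize P Side.rho (shift (fun _ => 1) (cherWord P (tWord m d hd) z)) := by
  have h := shiftedCherOp_mul_LopList P (n := n) hd (w := tWord m d hd)
    fun i hi => add_two_le_of_mem_tWord hi
  rw [smul_LopList, map_tWord_descLegs] at h
  rw [Lprod_eq, LprodRev_eq]
  exact congrFun h z

end Exchange

end EllipticRLL

end

open EllipticRLL

theorem mainTheorem9 (P : EllipticParams) (n : ℕ) :
    (∀ (m : ℕ) (s : Side), ∃ W : BraidMonoid m →* SkewAlg P n m,
      (∀ i : Fin (m - 1), W (PresentedMonoid.of (BraidRel m) i) =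
        SkewMonoidAlgebra.single (sigma i)
          (fun z => realize P s (cherGen P i z) : OpFun P n m)) ∧
      (∀ w : FreeMonoid (Fin (m - 1)), W (PresentedMonoid.mk (BraidRel m) w) =
        SkewMonoidAlgebra.single (permWord w)
          (fun z => realize P s (cherWord P w.toList z) : OpFun P n m))) ∧
    (∀ d : ℕ, 1 ≤ d → d ≤ n → ∀ z : Fin d → ℂˣ,
      realize P Side.lam (cherWord P (tWord d d le_rfl) z) * Lprod P n d le_rfl z =
        LprodRev P n d le_rfl z *
          realize P Side.rho (shift (fun _ => 1) (cherWord P (tWord d d le_rfl) z))) ∧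
    (∀ (d : ℕ) (_ : 1 ≤ d) (hd : d ≤ n) (z : Fin n → ℂˣ),
      realize P Side.lam (shift (hGe d) (cherWord P (tWord n d hd) z)) * Lprod P n d hd z =
        LprodRev P n d hd z *
          realize P Side.rho (shift (fun _ => 1) (cherWord P (tWord n d hd) z))) := by
  refine ⟨fun m s => ?_, fun d _ _ z => ?_, fun d _ hd z => realize_tWord_mul_Lprod P hd z⟩
  · obtain ⟨W, h1, h2⟩ := exists_braid_hom P (n := n) (m := m) s
    exact ⟨W, fun i => (h1 i).trans (congrArg (SkewMonoidAlgebra.single (sigma i))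
      (funext (cherOp_singleton P s i))), h2⟩
  · have h := realize_tWord_mul_Lprod P (n := n) (le_refl d) z
    -- There are no legs beyond the first `d`.
    have h0 : (hGe d : Fin d → ℤ) = 0 := funext fun k => if_neg (Nat.not_le.2 k.2)
    rwa [h0, shift_zero] at h
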